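/- All vector spaces are over $\mathbb C$, $\mathbb N=\{0,1,2,\dots\}$, and elements of $\mathbb Z_2$ are written $0,1$ in exponents of $-1$. **Conformal superalgebras.** A *conformal superalgebra* $(R,\partial,Y^+)$ is a $\mathbb Z_2$-graded $\mathbb C[\partial]$-module $R=R_0\oplus R_1$ with a $\mathbb Z_2$-graded linear map $Y^+(\cdot,z):R\to \mathrm{Hom}(R,R[z^{-1}]z^{-1})$ such that $Y^+(\partial u,z)=\frac{d}{dz}Y^+(u,z)$ and, for $u\in R_i$, $v\in R_j$, $$Y^+(u,z)v=(-1)^{ij}\,\mathrm{Res}_x\frac{e^{x\partial}Y^+(v,-x)u}{z-x},\tag{1.3}$$ $$Y^+(u,z_1)Y^+(v,z_2)-(-1)^{ij}Y^+(v,z_2)Y^+(u,z_1)=\mathrm{Res}_x\frac{Y^+(Y^+(u,z_1-x)v,x)}{z_2-x},\tag{1.4}$$ where binomials are expanded in nonnegative powers of the second variable. **Variational calculus.** Let $I_0,I_1$ be index sets and let $\mathcal A=\mathcal A_0\oplus\mathcal A_1$ be the free super-commutative algebra on formal variables $\psi_{\ell,j}^{(n)}$ ($\ell\in\mathbb Z_2$,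 $j\in I_\ell$, $n\in\mathbb N$) of parity $\ell$, with the even derivation $\frac{d}{dx}\psi_{\ell,j}^{(n)}=\psi_{\ell,j}^{(n+1)}$. Put $\tilde{\mathcal A}=\mathcal A/\frac{d}{dx}\mathcal A$, with quotient map $w\mapsto \tilde w$, and let $\tilde{\mathcal A}_0$ be the image of $\mathcal A_0$. Let $\bar{\mathcal G}_0$ be the space of families $\vec u=\{u_{\ell,j}\}$ with $u_{\ell,j}\in\mathcal A_\ell$, and $\Omega_0\subset\bar{\mathcal G}_0$ the subspace of families with finitely many nonzero components. For $\vec u\in\bar{\mathcal G}_0$ let $\partial_{\vec u}=\sum_{\ell,j,n}\left(\frac d{dx}\right)^n(u_{\ell,j})\,\partial_{\psi_{\ell,j}^{(n)}}$. Then $\bar{\mathcal G}_0$ is a Lie algebra with $[\vec u,\vec v]=\partial_{\vec u}(\vec v)-\partial_{\vec v}(\vec u)$ (derivations being applied componentwise), it acts on $\tilde{\mathcal A}_0$ by $\vec u(\tilde w)=(\partial_{\vec u}w)^\sim$, and $\vec u\in\Omega_0$ is regarded as the 1-form $\vec u(\vec v)=\big(\sum_{\ell,j}v_{\ell,j}u_{\ell,j}\big)^\sim$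 on $\bar{\mathcal G}_0$ with values in $\tilde{\mathcal A}_0$. A linear map $H:\Omega_0\to\bar{\mathcal G}_0$ is *skew-symmetric* if $\vec u(H\vec v)=-\vec v(H\vec u)$ for all $\vec u,\vec v\in\Omega_0$. It is a *Hamiltonian superoperator* if it is skew-symmetric, $H(\Omega_0)$ is a Lie subalgebra of $\bar{\mathcal G}_0$, and the (well-defined) 2-form $\omega_H(H\vec u,H\vec v)=\vec v(H\vec u)$ on $H(\Omega_0)$ with values in $\tilde{\mathcal A}_0$ is closed, $d\omega_H=0$. A *matrix differential operator* is a linear map $H:\Omega_0\to\bar{\mathcal G}_0$ of the form $H(\vec v)_{\ell_1,j_1}=\sum_{\ell_2,j_2,n}a^{\ell_1,j_1}_{\ell_2,j_2;n}\left(\frac{d}{dx}\right)^n(v_{\ell_2,j_2})$ with $a^{\ell_1,j_1}_{\ell_2,j_2;n}\in\mathcal A_{\ell_1+\ell_2}$, only finitely many of them nonzero for fixed $\ell_1,j_1,\ell_2,j_2$; put $[\partial_{\vec\xi}(H)(\vec v)]_{\ell_1,j_1}=\sum_{\ell_2,j_2,n}\partial_{\vec\xi}\big(a^{\ell_1,j_1}_{\ell_2,j_2;n}\big)\left(\frac{d}{dx}\right)^n(v_{\ell_2,j_2})$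 for $\vec\xi\in\bar{\mathcal G}_0$, $\vec v\in\Omega_0$. **Theorem 4.1.** Let $R=R_0\oplus R_1$ be a $\mathbb Z_2$-graded $\mathbb C[\partial]$-module which is free over a $\mathbb Z_2$-graded subspace $V=V_0\oplus V_1$ (that is, $\mathbb C[\partial]\otimes V\to R$ is bijective). Let $Y^+(\cdot,z):V\to\mathrm{Hom}(V,R[z^{-1}]z^{-1})$ be a linear map with $Y^+(V_i,z)V_j\subset R_{i+j}[z^{-1}]z^{-1}$ for $i,j\in\mathbb Z_2$, extended to $Y^+(\cdot,z):R\to\mathrm{Hom}(R,R[z^{-1}]z^{-1})$ by $$Y^+(f(\partial)u,z)v=f(d/dz)Y^+(u,z)v\qquad(f\in\mathbb C[\partial],\ u,v\in V),$$ $$Y^+(u,z)\partial^m v=\sum_{p=0}^m\binom mp\partial^{m-p}Y^+((-\partial)^pu,z)v\qquad(u\in R,\ v\in V,\ m\in\mathbb N).$$ Let $\{\varsigma_{\ell,j}\mid j\in I_\ell\}$ be a basis of $V_\ell$ for $\ell\in\mathbb Z_2$, and define $\lambda_{\ell_1,j_1;\ell_2,j_2}^{j_3,n,m}\in\mathbb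 C$ by $$Y^+(\varsigma_{\ell_1,j_1},z)\varsigma_{\ell_2,j_2}=\sum_{j_3\in I_{\ell_1+\ell_2},\ m,n\in\mathbb N}\lambda_{\ell_1,j_1;\ell_2,j_2}^{j_3,n,m}\,\partial^n\varsigma_{\ell_1+\ell_2,j_3}\,z^{-m-1}.$$ Let $H:\Omega_0\to\bar{\mathcal G}_0$ be the matrix differential operator $$H(\vec v)_{\ell_1,j_1}=\sum_{\ell_2\in\mathbb Z_2,\ j_2\in I_{\ell_2},\ j_3\in I_{\ell_1+\ell_2},\ m,n\in\mathbb N}\frac1{n!}\,\lambda_{\ell_2,j_2;\ell_1,j_1}^{j_3,m,n}\,\psi_{\ell_1+\ell_2,j_3}^{(m)}\left(\frac d{dx}\right)^n(v_{\ell_2,j_2}).$$ Then $(R,\partial,Y^+)$ is a conformal superalgebra if and only if $H$ is a Hamiltonian superoperator. Moreover, (1.3) holds (for all homogeneous $u,v\in R$) if and only if $H$ is skew-symmetric; and if $H$ is skew-symmetric, then (1.4) holds if and only if $$\vec u_3[\partial_{H(\vec u_2)}(H)(\vec u_1)]+\vec u_1[\partial_{H(\vec u_3)}(H)(\vec u_2)]+\vec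 u_2[\partial_{H(\vec u_1)}(H)(\vec u_3)]=0\qquad\text{for all }\vec u_1,\vec u_2,\vec u_3\in\Omega_0.\tag{2.62}$$ -/

import Mathlib

open Polynomial TensorProduct

namespace ConfHam

noncomputable section

/-- The sign `(-1)^{ij}` for `i, j ∈ ℤ/2`. -/
def sgn (i j : ZMod 2) : ℂ := (-1) ^ (i.val * j.val)

/-! ### Conformal superalgebras

`ℂ[∂]` is the polynomial ring `ℂ[X]`, the operator `∂` being the action of `X`. -/

section Conformal

variable {R : Type*} [AddCommGroup R] [Module ℂ R] [Module ℂ[X] R] [IsScalarTower ℂ ℂ[X] R]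

/-- `R = R₀ ⊕ R₁` is a `ℤ/2`-graded `ℂ[∂]`-module (`∂` preserves the parity). -/
structure IsGradedModule (𝓡 : ZMod 2 → Submodule ℂ R) : Prop where
  isInternal : DirectSum.IsInternal 𝓡
  partial_mem : ∀ i, ∀ u ∈ 𝓡 i, (X : ℂ[X]) • u ∈ 𝓡 i

/-- The space `M[z⁻¹]z⁻¹`: a finitely supported `f : ℕ →₀ M` stands for `∑ₘ f(m) z^{-m-1}`. -/
abbrev Polar (M : Type*) [AddCommGroup M] := ℕ →₀ M

/-- `d/dz` on `M[z⁻¹]z⁻¹`, that is `a z^{-m-1} ↦ -(m+1) a z^{-m-2}`. -/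
def ddz (M : Type*) [AddCommGroup M] [Module ℂ M] : Polar M →ₗ[ℂ] Polar M :=
  Finsupp.lsum ℂ fun m => (-((m : ℂ) + 1)) • Finsupp.lsingle (m + 1)

/-- The operator `∂` on `R`. -/
def del (R : Type*) [AddCommGroup R] [Module ℂ R] [Module ℂ[X] R] [IsScalarTower ℂ ℂ[X] R] :
    R →ₗ[ℂ] R :=
  Algebra.lsmul ℂ ℂ R (X : ℂ[X])

/-- The operator `∂` acting on the coefficients of a series in `R[z⁻¹]z⁻¹`. -/
def delCoeff (R : Type*) [AddCommGroup R] [Module ℂ R] [Module ℂ[X] R]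
    [IsScalarTower ℂ ℂ[X] R] : Polar R →ₗ[ℂ] Polar R :=
  Finsupp.mapRange.linearMap (del R)

/-- For `f(z) = ∑ₘ fₘ z^{-m-1}`, the coefficient of `z^{-l-1}` in
`Res_x e^{x∂} f(-x) / (z - x)`, where `1/(z - x) = ∑ₗ x^l z^{-l-1}`:
one needs the coefficient of `x^{-l-1}` in
`e^{x∂} f(-x) = ∑_{m,p} (-1)^{m+1} (∂^p fₘ / p!) x^{p-m-1}`, so `p = m - l`. -/
def skewCoeff (f : Polar R) (l : ℕ) : R :=
  f.sum fun m a =>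
    if l ≤ m then ((-1 : ℂ) ^ (m + 1) * ((m - l).factorial : ℂ)⁻¹) • (del R ^ (m - l)) a else 0

/-- The coefficient of `z₁^{-a-1} z₂^{-c-1}` in `Res_x Y(Y(u, z₁ - x)v, x)w / (z₂ - x)`.
Here `(z₁ - x)^{-m-1} = ∑_p (m+p choose p) x^p z₁^{-m-p-1}`, so `p = a - m`, and the
residue at `x` of `x^{c + p} Y(u₍ₘ₎v, x)w` is the coefficient of `x^{-(c+p)-1}`. -/
def jacobiCoeff (Y : R →ₗ[ℂ] R →ₗ[ℂ] Polar R) (u v w : R) (a c : ℕ) : R :=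
  (Y u v).sum fun m r =>
    if m ≤ a then (a.choose (a - m) : ℂ) • Y r w (c + (a - m)) else 0

/-- `Y` is a `ℤ/2`-graded map. -/
def IsGradedMap (𝓡 : ZMod 2 → Submodule ℂ R) (Y : R →ₗ[ℂ] R →ₗ[ℂ] Polar R) : Prop :=
  ∀ i j, ∀ u ∈ 𝓡 i, ∀ v ∈ 𝓡 j, ∀ m, Y u v m ∈ 𝓡 (i + j)

/-- `Y(∂u, z) = d/dz Y(u, z)`. -/
def Translation (Y : R →ₗ[ℂ] R →ₗ[ℂ] Polar R) : Prop :=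
  ∀ u v, Y ((X : ℂ[X]) • u) v = ddz R (Y u v)

/-- `Y(u,z)v = (-1)^{ij} Res_x e^{x∂} Y(v,-x)u / (z - x)` for `u ∈ Rᵢ`, `v ∈ Rⱼ`. -/
def SkewSymmetry (𝓡 : ZMod 2 → Submodule ℂ R) (Y : R →ₗ[ℂ] R →ₗ[ℂ] Polar R) : Prop :=
  ∀ i j, ∀ u ∈ 𝓡 i, ∀ v ∈ 𝓡 j, ∀ l, Y u v l = sgn i j • skewCoeff (Y v u) l

/-- `Y(u,z₁)Y(v,z₂) - (-1)^{ij} Y(v,z₂)Y(u,z₁) = Res_x Y(Y(u,z₁-x)v,x) / (z₂ - x)` for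
`u ∈ Rᵢ`, `v ∈ Rⱼ`, applied to any `w ∈ R`; coefficients of `z₁^{-a-1} z₂^{-c-1}`. -/
def JacobiIdentity (𝓡 : ZMod 2 → Submodule ℂ R) (Y : R →ₗ[ℂ] R →ₗ[ℂ] Polar R) : Prop :=
  ∀ i j, ∀ u ∈ 𝓡 i, ∀ v ∈ 𝓡 j, ∀ w a c,
    Y u (Y v w c) a - sgn i j • Y v (Y u w a) c = jacobiCoeff Y u v w a c

/-- `(R, ∂, Y)` is a conformal superalgebra, for the grading `R = 𝓡 0 ⊕ 𝓡 1`. -/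
structure IsConformalSuperalgebra (𝓡 : ZMod 2 → Submodule ℂ R)
    (Y : R →ₗ[ℂ] R →ₗ[ℂ] Polar R) : Prop where
  gradedModule : IsGradedModule 𝓡
  gradedMap : IsGradedMap 𝓡 Y
  translation : Translation Y
  skew : SkewSymmetry 𝓡 Y
  jacobi : JacobiIdentity 𝓡 Y

variable {V : Submodule ℂ R} (hV : IsBaseChange ℂ[X] V.subtype)
  (Y : V →ₗ[ℂ] V →ₗ[ℂ] Polar R)

/-- The isomorphism `R ≃ ℂ[∂] ⊗ V` of a `ℂ[∂]`-module `R` that is free over `V`. -/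
def freeEquiv : R ≃ₗ[ℂ] ℂ[X] ⊗[ℂ] V := (hV.equiv.restrictScalars ℂ).symm

lemma freeEquiv_smul (p : ℂ[X]) (v : V) : freeEquiv hV (p • (v : R)) = p ⊗ₜ v := by
  unfold freeEquiv
  rw [LinearEquiv.symm_apply_eq]
  exact (hV.equiv_tmul p v).symm

/-- First extension, `Y(f(∂)u, z)v = f(d/dz) Y(u,z)v` for `u, v ∈ V`. -/
def extLeft : R →ₗ[ℂ] V →ₗ[ℂ] Polar R :=
  (TensorProduct.lift (LinearMap.mk₂ ℂ
    (fun (p : ℂ[X]) (u : V) => (aeval (ddz R) p : Module.End ℂ (Polar R)) ∘ₗ Y u)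
    (fun p q u => by simp [LinearMap.add_comp])
    (fun c p u => by simp [LinearMap.smul_comp])
    (fun p u u' => by simp [LinearMap.comp_add])
    (fun c p u => by simp [LinearMap.comp_smul]))) ∘ₗ (freeEquiv hV).toLinearMap

/-- `Y(u,z)∂^m v = ∑_{p ≤ m} (m choose p) ∂^{m-p} Y((-∂)^p u, z)v` as a bilinear map of
`u ∈ R`, `v ∈ V`. -/
def powTerm (m : ℕ) : R →ₗ[ℂ] V →ₗ[ℂ] Polar R :=
  ∑ p ∈ Finset.range (m + 1),
    (m.choose p : ℂ) • (extLeft hV Y ∘ₗ (-del R) ^ p).compr₂ (delCoeff R ^ (m - p))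

/-- The full extension of `Y` to `R`. -/
def extend : R →ₗ[ℂ] R →ₗ[ℂ] Polar R :=
  LinearMap.mk₂ ℂ
    (fun u r => TensorProduct.lift
      ((Polynomial.lsum fun m => LinearMap.toSpanSingleton ℂ _ (powTerm hV Y m)).flip u)
      (freeEquiv hV r))
    (fun u u' r => by
      rw [map_add, ← LinearMap.add_apply]; congr 1; ext; simp)
    (fun c u r => by
      rw [map_smul, ← LinearMap.smul_apply]
      exact congrArg (fun g => g (freeEquiv hV r))
        ((TensorProduct.uncurry (.id ℂ) ℂ[X] V (Polar R)).map_smul c _))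
    (fun u r r' => by simp)
    (fun c u r => by simp)

lemma extLeft_smul (p : ℂ[X]) (u v : V) :
    extLeft hV Y (p • (u : R)) v = (aeval (ddz R) p : Module.End ℂ (Polar R)) (Y u v) := by
  simp [extLeft, freeEquiv_smul]

lemma extend_coe (u : R) (v : V) : extend hV Y u v = extLeft hV Y u v := by
  have h : freeEquiv hV (v : R) = 1 ⊗ₜ v := by simpa using freeEquiv_smul hV 1 v
  rw [extend, LinearMap.mk₂_apply, h, TensorProduct.lift.tmul, LinearMap.flip_apply,
    Polynomial.lsum_apply, ← Polynomial.C_1, Polynomial.sum_C_index] <;> simp [powTerm]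

/-- The extension satisfies `Y(f(∂)u, z)v = f(d/dz) Y(u,z)v` for `u, v ∈ V`. -/
theorem extend_smul_left (p : ℂ[X]) (u v : V) :
    extend hV Y (p • (u : R)) v = (aeval (ddz R) p : Module.End ℂ (Polar R)) (Y u v) := by
  rw [extend_coe, extLeft_smul]

/-- The extension satisfies
`Y(u,z)∂^m v = ∑_{p ≤ m} (m choose p) ∂^{m-p} Y((-∂)^p u, z)v` for `u ∈ R`, `v ∈ V`. -/
theorem extend_pow_right (u : R) (v : V) (m : ℕ) :
    extend hV Y u ((del R ^ m) v) = ∑ p ∈ Finset.range (m + 1),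
      (m.choose p : ℂ) • (delCoeff R ^ (m - p)) (extend hV Y (((-del R) ^ p) u) v) := by
  have h0 : ∀ m, ∀ r : R, (del R ^ m) r = (X ^ m : ℂ[X]) • r := by
    intro m
    induction m with
    | zero => simp
    | succ k ih => intro r; rw [pow_succ', Module.End.mul_apply, ih, pow_succ', mul_smul]; rfl
  simp only [extend_coe]
  rw [h0, extend, LinearMap.mk₂_apply, freeEquiv_smul, TensorProduct.lift.tmul,
    LinearMap.flip_apply, Polynomial.lsum_apply, ← Polynomial.monomial_one_right_eq_X_pow,
    Polynomial.sum_monomial_index] <;> simp [powTerm, LinearMap.sum_apply]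

end Conformal

/-! ### The super-commutative differential algebra `𝒜`

`ι ℓ` is the index set `I_ℓ` for `ℓ ∈ ℤ/2`. -/

section Variational

/-- Pairs `(ℓ, j)` with `ℓ ∈ ℤ/2` and `j ∈ I_ℓ`. -/
abbrev Idx (ι : ZMod 2 → Type*) := Σ ℓ : ZMod 2, ι ℓ

/-- Indices `((ℓ, j), n)` of the formal variables `ψ_{ℓ,j}^{(n)}`, which have parity `ℓ`. -/
abbrev Var (ι : ZMod 2 → Type*) := Idx ι × ℕ

/-- The relations `xy = (-1)^{ij} yx` between variables `x`, `y` of parities `i`, `j`. -/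
inductive SuperRel (ι : ZMod 2 → Type*) :
    FreeAlgebra ℂ (Var ι) → FreeAlgebra ℂ (Var ι) → Prop
  | comm (a b : Var ι) : SuperRel ι (FreeAlgebra.ι ℂ a * FreeAlgebra.ι ℂ b)
      (sgn a.1.1 b.1.1 • (FreeAlgebra.ι ℂ b * FreeAlgebra.ι ℂ a))

/-- `𝒜`: the free super-commutative algebra on the formal variables `ψ_{ℓ,j}^{(n)}`. -/
def SAlg (ι : ZMod 2 → Type*) := RingQuot (SuperRel ι)

variable {ι : ZMod 2 → Type*}

instance : Ring (SAlg ι) := inferInstanceAs (Ring (RingQuot (SuperRel ι)))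

instance : Algebra ℂ (SAlg ι) := inferInstanceAs (Algebra ℂ (RingQuot (SuperRel ι)))

/-- The quotient map onto `𝒜`. -/
def SAlg.mk (ι : ZMod 2 → Type*) : FreeAlgebra ℂ (Var ι) →ₐ[ℂ] SAlg ι :=
  RingQuot.mkAlgHom ℂ (SuperRel ι)

lemma SAlg.mk_rel {x y : FreeAlgebra ℂ (Var ι)} (h : SuperRel ι x y) :
    SAlg.mk ι x = SAlg.mk ι y := RingQuot.mkAlgHom_rel ℂ h

lemma SAlg.mk_surjective : Function.Surjective (SAlg.mk ι) :=
  RingQuot.mkAlgHom_surjective ℂ (SuperRel ι)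

/-- The universal property of the quotient `𝒜`. -/
def SAlg.lift {B : Type*} [Semiring B] [Algebra ℂ B] (f : FreeAlgebra ℂ (Var ι) →ₐ[ℂ] B)
    (hf : ∀ x y, SuperRel ι x y → f x = f y) : SAlg ι →ₐ[ℂ] B :=
  RingQuot.liftAlgHom ℂ ⟨f, fun x y h => hf x y h⟩

lemma SAlg.lift_mk {B : Type*} [Semiring B] [Algebra ℂ B] (f : FreeAlgebra ℂ (Var ι) →ₐ[ℂ] B)
    (hf : ∀ x y, SuperRel ι x y → f x = f y) (x : FreeAlgebra ℂ (Var ι)) :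
    SAlg.lift f hf (SAlg.mk ι x) = f x :=
  RingQuot.liftAlgHom_mkAlgHom_apply ℂ f _ x

/-- The variable `ψ_{ℓ,j}^{(n)}` in `𝒜`, for `k = (ℓ, j)`. -/
def psi (k : Idx ι) (n : ℕ) : SAlg ι := SAlg.mk ι (FreeAlgebra.ι ℂ (k, n))

/-- `𝒜ᵢ`: the span of the products of variables whose parities add up to `i`. -/
def homog (ι : ZMod 2 → Type*) (i : ZMod 2) : Submodule ℂ (SAlg ι) :=
  Submodule.span ℂ {x | ∃ l : List (Var ι),
    (l.map fun a => a.1.1).sum = i ∧ x = (l.map fun a => psi a.1 a.2).prod}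

lemma psi_comm (a b : Var ι) :
    psi a.1 a.2 * psi b.1 b.2 = sgn a.1.1 b.1.1 • (psi b.1 b.2 * psi a.1 a.2) := by
  have := SAlg.mk_rel (SuperRel.comm a b)
  simpa [psi] using this

lemma psi_mem (k : Idx ι) (n : ℕ) : psi k n ∈ homog ι k.1 :=
  Submodule.subset_span ⟨[(k, n)], by simp, by simp⟩

lemma sgn_add_left (i j k : ZMod 2) : sgn (i + j) k = sgn i k * sgn j k := by
  have h : ∀ i j k : ZMod 2, ((i + j).val * k.val) % 2 = (i.val * k.val + j.val * k.val) % 2 := by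
    decide
  unfold sgn
  rw [← pow_add, neg_one_pow_eq_pow_mod_two, h, ← neg_one_pow_eq_pow_mod_two]

lemma sgn_comm (i j : ZMod 2) : sgn i j = sgn j i := by simp [sgn, mul_comm]

lemma sgn_zero_left (j : ZMod 2) : sgn 0 j = 1 := by simp [sgn]

lemma sgn_mul_self (i j : ZMod 2) : sgn i j * sgn i j = 1 := by
  simp [sgn, ← mul_pow]

lemma mul_mem_homog {i j : ZMod 2} {x y : SAlg ι} (hx : x ∈ homog ι i) (hy : y ∈ homog ι j) :
    x * y ∈ homog ι (i + j) := by
  induction hx using Submodule.span_induction with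
  | zero => simp
  | add x x' _ _ h h' => rw [add_mul]; exact add_mem h h'
  | smul c x _ h => rw [smul_mul_assoc]; exact Submodule.smul_mem _ _ h
  | mem x hx =>
    obtain ⟨l, hl, rfl⟩ := hx
    induction hy using Submodule.span_induction with
    | zero => simp
    | add x x' _ _ h h' => rw [mul_add]; exact add_mem h h'
    | smul c x _ h => rw [mul_smul_comm]; exact Submodule.smul_mem _ _ h
    | mem y hy =>
      obtain ⟨l', hl', rfl⟩ := hy
      exact Submodule.subset_span ⟨l ++ l', by simp [hl, hl'], by simp⟩

lemma psi_list_comm (a : Var ι) (l : List (Var ι)) :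
    psi a.1 a.2 * (l.map fun a => psi a.1 a.2).prod =
      sgn a.1.1 (l.map fun a => a.1.1).sum • ((l.map fun a => psi a.1 a.2).prod * psi a.1 a.2) := by
  induction l with
  | nil => simp [sgn]
  | cons b l ih =>
    simp only [List.map_cons, List.prod_cons, List.sum_cons]
    rw [← mul_assoc, psi_comm, smul_mul_assoc, mul_assoc, ih, mul_smul_comm, smul_smul,
      ← mul_assoc, sgn_comm a.1.1 (_ + _), sgn_add_left, sgn_comm a.1.1, sgn_comm a.1.1]

/-- A variable super-commutes with every homogeneous element. -/
lemma psi_homog_comm (a : Var ι) {j : ZMod 2} {y : SAlg ι} (hy : y ∈ homog ι j) :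
    psi a.1 a.2 * y = sgn a.1.1 j • (y * psi a.1 a.2) := by
  induction hy using Submodule.span_induction with
  | zero => simp
  | add x x' _ _ h h' => simp [mul_add, add_mul, h, h']
  | smul c x _ h => simp [h, smul_comm c]
  | mem y hy =>
    obtain ⟨l, rfl, rfl⟩ := hy
    exact psi_list_comm a l

/-- The algebra map `𝒜 → 𝒜[ε]`, `ε² = 0`, with `ψ ↦ ψ + ε f(ψ)`. -/
def evenDerHom (f : Var ι → SAlg ι) (hf : ∀ a : Var ι, f a ∈ homog ι a.1.1) :
    SAlg ι →ₐ[ℂ] TrivSqZeroExt (SAlg ι) (SAlg ι) :=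
  SAlg.lift (FreeAlgebra.lift ℂ fun a =>
      TrivSqZeroExt.inl (psi a.1 a.2) + TrivSqZeroExt.inr (f a)) (by
    rintro x y ⟨a, b⟩
    have h1 := psi_homog_comm a (hf b)
    have h2 := psi_homog_comm b (hf a)
    have h3 : f a * psi b.1 b.2 = sgn a.1.1 b.1.1 • (psi b.1 b.2 * f a) := by
      rw [h2, smul_smul, sgn_comm b.1.1, sgn_mul_self, one_smul]
    ext
    · simpa using psi_comm a b
    · simp [h1, h3, add_comm])

/-- The even derivation `∑ f(ψ) ∂_ψ` of `𝒜` (sum over all variables `ψ = ψ_{ℓ,j}^{(n)}`), for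
values `f(ψ)` of the same parity as `ψ`: the derivation of `𝒜` that sends `ψ` to `f(ψ)`. -/
def evenDer (f : Var ι → SAlg ι) (hf : ∀ a : Var ι, f a ∈ homog ι a.1.1) : SAlg ι →ₗ[ℂ] SAlg ι where
  toFun x := (evenDerHom f hf x).snd
  map_add' x y := by rw [map_add, TrivSqZeroExt.snd_add]
  map_smul' c x := by rw [map_smul, TrivSqZeroExt.snd_smul, RingHom.id_apply]

lemma evenDer_psi (f : Var ι → SAlg ι) (hf : ∀ a : Var ι, f a ∈ homog ι a.1.1) (a : Var ι) :
    evenDer f hf (psi a.1 a.2) = f a := by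
  simp [evenDer, evenDerHom, psi, SAlg.lift_mk]

lemma fst_evenDerHom (f : Var ι → SAlg ι) (hf : ∀ a : Var ι, f a ∈ homog ι a.1.1) (x : SAlg ι) :
    (evenDerHom f hf x).fst = x := by
  have : ((TrivSqZeroExt.fstHom ℂ (SAlg ι) (SAlg ι)).comp (evenDerHom f hf)).comp (SAlg.mk ι) =
      SAlg.mk ι := by
    ext a
    simp [evenDerHom, psi, SAlg.lift_mk]
  obtain ⟨x, rfl⟩ := SAlg.mk_surjective x
  exact congrArg (fun g => g x) this

lemma evenDer_mul (f : Var ι → SAlg ι) (hf : ∀ a : Var ι, f a ∈ homog ι a.1.1) (x y : SAlg ι) :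
    evenDer f hf (x * y) = evenDer f hf x * y + x * evenDer f hf y := by
  simp [evenDer, fst_evenDerHom, add_comm]

lemma evenDer_one (f : Var ι → SAlg ι) (hf : ∀ a : Var ι, f a ∈ homog ι a.1.1) :
    evenDer f hf 1 = 0 := by
  simp [evenDer]

lemma evenDer_mem (f : Var ι → SAlg ι) (hf : ∀ a : Var ι, f a ∈ homog ι a.1.1) {i : ZMod 2}
    {x : SAlg ι} (hx : x ∈ homog ι i) : evenDer f hf x ∈ homog ι i := by
  induction hx using Submodule.span_induction with
  | zero => simp
  | add x x' _ _ h h' => rw [map_add]; exact add_mem h h'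
  | smul c x _ h => rw [map_smul]; exact Submodule.smul_mem _ _ h
  | mem x hx =>
    obtain ⟨l, rfl, rfl⟩ := hx
    induction l with
    | nil => simp [evenDer_one]
    | cons a l ih =>
      simp only [List.map_cons, List.prod_cons, List.sum_cons, evenDer_mul, evenDer_psi]
      exact add_mem (mul_mem_homog (hf a) (Submodule.subset_span ⟨l, rfl, rfl⟩))
        (mul_mem_homog (psi_mem _ _) ih)

lemma psi_induction {p : SAlg ι → Prop} (h1 : ∀ c : ℂ, p (algebraMap ℂ _ c))
    (hpsi : ∀ a : Var ι, p (psi a.1 a.2)) (hmul : ∀ x y, p x → p y → p (x * y))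
    (hadd : ∀ x y, p x → p y → p (x + y)) (x : SAlg ι) : p x := by
  obtain ⟨x, rfl⟩ := SAlg.mk_surjective x
  induction x using FreeAlgebra.induction with
  | grade0 r => rw [AlgHom.commutes]; exact h1 r
  | grade1 a => exact hpsi a
  | mul x y hx hy => rw [map_mul]; exact hmul _ _ hx hy
  | add x y hx hy => rw [map_add]; exact hadd _ _ hx hy

/-- `d/dx = ∑ ψ_{ℓ,j}^{(n+1)} ∂_{ψ_{ℓ,j}^{(n)}}` on `𝒜`. -/
def ddx (ι : ZMod 2 → Type*) : SAlg ι →ₗ[ℂ] SAlg ι :=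
  evenDer (fun a => psi a.1 (a.2 + 1)) fun a => psi_mem a.1 (a.2 + 1)

lemma ddx_pow_mem {i : ZMod 2} {x : SAlg ι} (hx : x ∈ homog ι i) (n : ℕ) :
    (ddx ι ^ n) x ∈ homog ι i := by
  induction n with
  | zero => simpa
  | succ n ih => rw [pow_succ', Module.End.mul_apply]; exact evenDer_mem _ _ ih

/-- `𝒢̄₀`: the families `u = {u_{ℓ,j}}` with `u_{ℓ,j} ∈ 𝒜_ℓ`. -/
def GBar (ι : ZMod 2 → Type*) : Submodule ℂ (Idx ι → SAlg ι) :=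
  Submodule.pi Set.univ fun k => homog ι k.1

/-- `Ω₀`: the elements of `𝒢̄₀` with only finitely many nonzero components. -/
def Omega (ι : ZMod 2 → Type*) : Submodule ℂ (Idx ι →₀ SAlg ι) :=
  (GBar ι).comap Finsupp.lcoeFun

lemma gBar_mem (u : GBar ι) (k : Idx ι) : u.1 k ∈ homog ι k.1 := u.2 k trivial

lemma omega_mem (u : Omega ι) (k : Idx ι) : u.1 k ∈ homog ι k.1 := u.2 k trivial

/-- `∂_u = ∑ (d/dx)^n(u_{ℓ,j}) ∂_{ψ_{ℓ,j}^{(n)}}` for `u ∈ 𝒢̄₀`. -/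
def der (u : GBar ι) : SAlg ι →ₗ[ℂ] SAlg ι :=
  evenDer (fun a => (ddx ι ^ a.2) (u.1 a.1)) fun a => ddx_pow_mem (gBar_mem u a.1) a.2

lemma der_ddx (u : GBar ι) (x : SAlg ι) : der u (ddx ι x) = ddx ι (der u x) := by
  induction x using psi_induction with
  | h1 c => simp [Algebra.algebraMap_eq_smul_one, der, ddx, evenDer_one]
  | hpsi a =>
    have h1 : ddx ι (psi a.1 a.2) = psi a.1 (a.2 + 1) := evenDer_psi _ _ a
    have h2 : ∀ a : Var ι, der u (psi a.1 a.2) = (ddx ι ^ a.2) (u.1 a.1) := evenDer_psi _ _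
    rw [h1, h2 a, h2 (a.1, a.2 + 1), pow_succ', Module.End.mul_apply]
  | hmul x y hx hy =>
    have e1 : ∀ x y, ddx ι (x * y) = ddx ι x * y + x * ddx ι y := evenDer_mul _ _
    have e2 : ∀ x y, der u (x * y) = der u x * y + x * der u y := evenDer_mul _ _
    simp only [e1, e2, map_add, hx, hy]
    abel
  | hadd x y hx hy => simp [hx, hy]

/-- The Lie bracket `[u, v] = ∂_u(v) - ∂_v(u)` of `𝒢̄₀`. -/
def bracket (u v : GBar ι) : GBar ι :=
  ⟨fun k => der u (v.1 k) - der v (u.1 k), fun k _ =>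
    sub_mem (evenDer_mem _ _ (gBar_mem v k)) (evenDer_mem _ _ (gBar_mem u k))⟩

/-- `𝒜̃ = 𝒜 / (d/dx)(𝒜)`. -/
abbrev ATilde (ι : ZMod 2 → Type*) := SAlg ι ⧸ LinearMap.range (ddx ι)

/-- The canonical map `𝒜 → 𝒜̃`. -/
def tilde : SAlg ι →ₗ[ℂ] ATilde ι := (LinearMap.range (ddx ι)).mkQ

/-- The action `u(w̃) = (∂_u w)~` of `𝒢̄₀` on `𝒜̃`. -/
def act (u : GBar ι) : ATilde ι →ₗ[ℂ] ATilde ι :=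
  Submodule.mapQ _ _ (der u) (by
    rintro _ ⟨x, rfl⟩
    exact ⟨der u x, (der_ddx u x).symm⟩)

/-- `𝒜̃₀`: the even part of `𝒜̃`, the image of `𝒜₀`. -/
def ATilde₀ (ι : ZMod 2 → Type*) : Submodule ℂ (ATilde ι) := (homog ι 0).map tilde

lemma act_mem (u : GBar ι) {x : ATilde ι} (hx : x ∈ ATilde₀ ι) : act u x ∈ ATilde₀ ι := by
  obtain ⟨x, hx, rfl⟩ := hx
  exact ⟨der u x, evenDer_mem _ _ hx, rfl⟩

/-- The action of `𝒢̄₀` on `𝒜̃₀`. -/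
def act₀ (u : GBar ι) : ATilde₀ ι →ₗ[ℂ] ATilde₀ ι := (act u).restrict fun _ hx => act_mem u hx

/-- An element `u ∈ Ω₀` as a 1-form of `𝒢̄₀` with values in `𝒜̃₀`:
`u(v) = (∑_{ℓ,j} v_{ℓ,j} u_{ℓ,j})~`. -/
def pair (u : Omega ι) (v : GBar ι) : ATilde₀ ι :=
  ⟨tilde (∑ k ∈ u.1.support, v.1 k * u.1 k), _, sum_mem fun k _ => by
    simpa [CharTwo.add_self_eq_zero] using mul_mem_homog (gBar_mem v k) (omega_mem u k), rfl⟩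

/-! ### Hamiltonian superoperators -/

/-- Super skew-symmetry of `H : Ω₀ → 𝒢̄₀` (everything is even here):
`φ₁(H φ₂) = -φ₂(H φ₁)`. -/
def IsSkew (H : Omega ι →ₗ[ℂ] GBar ι) : Prop :=
  ∀ φ₁ φ₂, pair φ₁ (H φ₂) = -pair φ₂ (H φ₁)

/-- The differential `dω` of a 2-form `ω` with values in `𝒜̃₀` on a subalgebra `L` of the Lie
algebra `𝒢̄₀`:
`dω(ξ₁,ξ₂,ξ₃) = ξ₁ω(ξ₂,ξ₃) - ξ₂ω(ξ₁,ξ₃) + ξ₃ω(ξ₁,ξ₂)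
  - ω([ξ₁,ξ₂],ξ₃) + ω([ξ₁,ξ₃],ξ₂) - ω([ξ₂,ξ₃],ξ₁)`. -/
def dTwo (L : Submodule ℂ (GBar ι)) (hL : ∀ ξ ∈ L, ∀ η ∈ L, bracket ξ η ∈ L)
    (ω : L →ₗ[ℂ] L →ₗ[ℂ] ATilde₀ ι) (ξ₁ ξ₂ ξ₃ : L) : ATilde₀ ι :=
  act₀ ξ₁.1 (ω ξ₂ ξ₃) - act₀ ξ₂.1 (ω ξ₁ ξ₃) + act₀ ξ₃.1 (ω ξ₁ ξ₂)
    - ω ⟨bracket ξ₁.1 ξ₂.1, hL _ ξ₁.2 _ ξ₂.2⟩ ξ₃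
    + ω ⟨bracket ξ₁.1 ξ₃.1, hL _ ξ₁.2 _ ξ₃.2⟩ ξ₂
    - ω ⟨bracket ξ₂.1 ξ₃.1, hL _ ξ₂.2 _ ξ₃.2⟩ ξ₁

/-- `H : Ω₀ → 𝒢̄₀` is a Hamiltonian superoperator: it is super skew-symmetric, its image
`H(Ω₀)` is a subalgebra of `𝒢̄₀`, and `ω_H(Hφ₁, Hφ₂) = φ₂(Hφ₁)` is a well-defined closed 2-form
on `H(Ω₀)` (`ω_H` is unique, as its values are prescribed). -/
structure IsHamiltonian (H : Omega ι →ₗ[ℂ] GBar ι) : Prop where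
  skew : IsSkew H
  subalgebra : ∀ ξ ∈ LinearMap.range H, ∀ η ∈ LinearMap.range H, bracket ξ η ∈ LinearMap.range H
  closed : ∃ ω : LinearMap.range H →ₗ[ℂ] LinearMap.range H →ₗ[ℂ] ATilde₀ ι,
    (∀ ξ η, ω ξ η = -ω η ξ) ∧
    (∀ φ₁ φ₂, ω (H.rangeRestrict φ₁) (H.rangeRestrict φ₂) = pair φ₂ (H φ₁)) ∧
    ∀ ξ₁ ξ₂ ξ₃, dTwo (LinearMap.range H) subalgebra ω ξ₁ ξ₂ ξ₃ = 0

/-- The coefficients `a^{r}_{c;n}` (row `r`, column `c`) of a matrix differential operator: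
`a^{r}_{c;n} ∈ 𝒜_{|r|+|c|}`, only finitely many of them nonzero for fixed `r` and `c`. -/
structure MatDiffOp (ι : ZMod 2 → Type*) where
  coeff : Idx ι → Idx ι → ℕ →₀ SAlg ι
  coeff_mem : ∀ r c n, coeff r c n ∈ homog ι (r.1 + c.1)

namespace MatDiffOp

/-- `∑ₙ aₙ (d/dx)^n` as a linear operator on `𝒜`. -/
def diffOp (a : ℕ →₀ SAlg ι) : SAlg ι →ₗ[ℂ] SAlg ι :=
  ∑ n ∈ a.support, LinearMap.mulLeft ℂ (a n) ∘ₗ ddx ι ^ n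

/-- The linear map `H : Ω₀ → 𝒢̄₀` with
`H(v)_r = ∑_c ∑ₙ a^{r}_{c;n} (d/dx)^n (v_c)`. -/
def toLin (H : MatDiffOp ι) : Omega ι →ₗ[ℂ] GBar ι :=
  LinearMap.codRestrict (GBar ι)
    ((LinearMap.pi fun r => Finsupp.lsum ℂ fun c => diffOp (H.coeff r c)) ∘ₗ (Omega ι).subtype)
    (by
      intro v r _
      simp only [LinearMap.comp_apply, LinearMap.pi_apply, Finsupp.lsum_apply,
        Submodule.subtype_apply, Finsupp.sum, diffOp, LinearMap.sum_apply]
      refine sum_mem fun c _ => sum_mem fun n _ => ?_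
      have := mul_mem_homog (H.coeff_mem r c n) (ddx_pow_mem (omega_mem v c) n)
      rwa [add_assoc, CharTwo.add_self_eq_zero, add_zero] at this)

/-- `∂_ξ(H)` applied to `v`, for `ξ ∈ 𝒢̄₀` and `v ∈ Ω₀`:
`[∂_ξ(H)(v)]_r = ∑_c ∑ₘ ∂_ξ(a^{r}_{c;m}) (d/dx)^m (v_c)`. -/
def derApply (H : MatDiffOp ι) (ξ : GBar ι) (v : Omega ι) : GBar ι :=
  ⟨fun r => ∑ c ∈ v.1.support, ∑ m ∈ (H.coeff r c).support,
      der ξ (H.coeff r c m) * (ddx ι ^ m) (v.1 c), fun r _ => by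
    refine sum_mem fun c _ => sum_mem fun n _ => ?_
    have := mul_mem_homog (evenDer_mem _ (fun a => ddx_pow_mem (gBar_mem ξ a.1) a.2)
      (H.coeff_mem r c n)) (ddx_pow_mem (omega_mem v c) n)
    rwa [add_assoc, CharTwo.add_self_eq_zero, add_zero] at this⟩

/-- The closedness condition
`u₃[∂_{H(u₂)}(H)(u₁)] + u₁[∂_{H(u₃)}(H)(u₂)] + u₂[∂_{H(u₁)}(H)(u₃)] = 0` for all
`u₁, u₂, u₃ ∈ Ω₀`. -/
def Closedness (H : MatDiffOp ι) : Prop :=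
  ∀ u₁ u₂ u₃ : Omega ι,
    pair u₃ (H.derApply (H.toLin u₂) u₁) + pair u₁ (H.derApply (H.toLin u₃) u₂) +
      pair u₂ (H.derApply (H.toLin u₁) u₃) = 0

end MatDiffOp

/-! ### The operator attached to `(R, V, Y)` -/

variable {R : Type*} [AddCommGroup R] [Module ℂ R] [Module ℂ[X] R] [IsScalarTower ℂ ℂ[X] R]
  {V : Submodule ℂ R} (hV : IsBaseChange ℂ[X] V.subtype) (b : Module.Basis (Idx ι) ℂ V)
  (Y : V →ₗ[ℂ] V →ₗ[ℂ] Polar R)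

/-- The structure constants `λ_{k₁;k₂}^{k₃,n,m}`, where
`Y(ς_{k₁}, z)ς_{k₂} = ∑ λ_{k₁;k₂}^{k₃,n,m} ∂^n ς_{k₃} z^{-m-1}` for the basis `ς = b` of `V`;
`hV.basis b` is the basis `ς` of the free `ℂ[∂]`-module `R`. -/
def structConst (k₁ k₂ k₃ : Idx ι) (n m : ℕ) : ℂ :=
  ((hV.basis b).repr (Y (b k₁) (b k₂) m) k₃).coeff n

/-- The coefficient of `(d/dx)^n` in the entry with row `r` and column `c` of the operator:
`(1/n!) ∑ λ_{c;r}^{k,m,n} ψ_k^{(m)}`, the sum being over `k = (ℓ_c + ℓ_r, j)`, `j ∈ I_{ℓ_c + ℓ_r}`,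
and `m ∈ ℕ`; only those `(k, m)` are listed for which `λ` can be nonzero. -/
def opCoeff (r c : Idx ι) (n : ℕ) : SAlg ι :=
  ∑ k ∈ ((hV.basis b).repr (Y (b c) (b r) n)).support with k.1 = c.1 + r.1,
    ∑ m ∈ ((hV.basis b).repr (Y (b c) (b r) n) k).support,
      ((n.factorial : ℂ)⁻¹ * structConst hV b Y c r k m n) • psi k m

/-- The matrix differential operator
`H(v)_r = ∑ (1/n!) λ_{c;r}^{k,m,n} ψ_k^{(m)} (d/dx)^n (v_c)`. -/
def hamOp : MatDiffOp ι where
  coeff r c := Finsupp.onFinset (Y (b c) (b r)).support (opCoeff hV b Y r c) (by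
    intro n hn
    rw [Finsupp.mem_support_iff]
    rintro h
    exact hn (by simp [opCoeff, h]))
  coeff_mem r c n := by
    refine sum_mem fun k hk => sum_mem fun m _ => Submodule.smul_mem _ _ ?_
    rw [add_comm, ← (Finset.mem_filter.1 hk).2]
    exact psi_mem k m

end Variational

end

end ConfHam

/-!
The operator `H` is a bracket on `R ⊗ 𝒜` in disguise. Embed `R` into `𝒜` as the span of the
variables by `∂ⁿς_k ↦ ψ_k^{(n)}` (`symb`). Then
`H(f ς_c)_r = ∑ (1/n!) symb(ς_c₍ₙ₎ς_r) f^{(n)}`,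
and by sesquilinearity the derivation `∂_{H(f ς_c)}` of `𝒜` is
`symb a ↦ ∑ (1/n!) symb(ς_c₍ₙ₎a) f^{(n)}` for all `a ∈ R` (`der_toLin_symb`). Both identities for
`R` can be tested on generators, again by sesquilinearity (`skewSymmetry_iff`,
`jacobiIdentity_iff`), and there they become identities in `𝒜`:

* Integration by parts and the Leibniz rule turn `u(Hv) + v(Hu)`, for `v = f ς_c` and `u = g ς_r`,
  into the class of `(∑ (1/n!) symb(dₙ) f^{(n)}) g`, where `dₙ` is the defect of (super)
  skew-symmetry (`pair_hamOp_single`).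
* Let `ζ` be the 1-form `ξ ↦ u₂(∂_ξ(H)(u₁))`, for `u₁ = f ς_c` and `u₂ = g ς_s`. The component
  `r` of `∂_{Hu₁}(H)(u₂) - ∂_{Hu₂}(H)(u₁) - Hζ` is
  `∑ (1/(n! m!)) symb(Jₘₙ) f^{(n)} g^{(m)}`, where `Jₘₙ` is the defect of the Jacobi identity
  (`exists_form_single`). If `H` is skew-symmetric, then pairing this family with `u₃` gives minus
  the cyclic sum in the closedness condition (`pair_derApply_sub`).

To return from classes modulo total derivatives to `R` one needs that the pairing `(x, y) ↦ (x y)~`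
is non-degenerate (`eq_zero_of_mul_mem_range_ddx`), and that taking derivatives of very high order
for `f` and `g` separates the coefficients of a symbol (`eq_zero_of_sum_mul_psi`). Both rest on the
super-derivations `∂/∂ψ_k^{(n)}` of `𝒜` (`partialDer`).

For the Hamiltonian property, the differential of `ω_H` at `(Hu₁, Hu₂, Hu₃)` is the cyclic sum
(`dTwo_eq`). That `H(Ω₀)` is a subalgebra follows from the vanishing of
`∂_{Hu₁}(H)(u₂) - ∂_{Hu₂}(H)(u₁) - Hζ`, which gives
`[Hu₁, Hu₂] = H(∂_{Hu₁}(u₂) - ∂_{Hu₂}(u₁) + ζ)` (`isHamiltonian_of_skew`).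
-/

set_option linter.unusedSectionVars false

namespace ConfHam

noncomputable section

/-! ### The calculus of super-derivations of `𝒜` -/

section SuperDerivations

variable {ι : ZMod 2 → Type*}

lemma sgn_self_one : sgn 1 1 = -1 := by
  rw [sgn, show (1 : ZMod 2).val = 1 from rfl]; simp

lemma eq_zero_of_eq_neg {x : SAlg ι} (h : x = -x) : x = 0 := by
  have h1 : (2 : ℂ) • x = 0 := by rw [two_smul]; exact add_eq_zero_iff_eq_neg.2 h
  simpa using h1

lemma homog_comm {i j : ZMod 2} {x y : SAlg ι} (hx : x ∈ homog ι i) (hy : y ∈ homog ι j) :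
    x * y = sgn i j • (y * x) := by
  induction hx using Submodule.span_induction with
  | zero => simp
  | add x x' _ _ h h' => simp [mul_add, add_mul, h, h']
  | smul c x _ h => simp [h, smul_comm c]
  | mem x hx =>
    obtain ⟨l, rfl, rfl⟩ := hx
    induction l with
    | nil => simp [sgn_zero_left]
    | cons a l ih =>
      simp only [List.map_cons, List.prod_cons, List.sum_cons]
      rw [mul_assoc, ih, mul_smul_comm, ← mul_assoc, psi_homog_comm a hy, smul_mul_assoc,
        smul_smul, mul_assoc, sgn_add_left, mul_comm (sgn _ j)]

/-- The automorphism of `𝒜` that is multiplication by `(-1)^{ij}` on `𝒜ⱼ`. -/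
def twist (ι : ZMod 2 → Type*) (i : ZMod 2) : SAlg ι →ₐ[ℂ] SAlg ι :=
  SAlg.lift (FreeAlgebra.lift ℂ fun a => sgn i a.1.1 • psi a.1 a.2) (by
    rintro x y ⟨a, b⟩
    simp only [map_mul, map_smul, FreeAlgebra.lift_ι_apply, smul_mul_smul_comm]
    rw [psi_comm, smul_comm, mul_comm (sgn i _)])

lemma twist_psi (i : ZMod 2) (a : Var ι) :
    twist ι i (psi a.1 a.2) = sgn i a.1.1 • psi a.1 a.2 := by
  simp [twist, psi, SAlg.lift_mk]

lemma twist_zero (x : SAlg ι) : twist ι 0 x = x := by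
  induction x using psi_induction with
  | h1 c => simp
  | hpsi a => simp [twist_psi, sgn_zero_left]
  | hmul x y hx hy => simp [hx, hy]
  | hadd x y hx hy => simp [hx, hy]

lemma twist_twist (i : ZMod 2) (x : SAlg ι) : twist ι i (twist ι i x) = x := by
  induction x using psi_induction with
  | h1 c => simp
  | hpsi a => simp [twist_psi, smul_smul, sgn_mul_self]
  | hmul x y hx hy => simp [hx, hy]
  | hadd x y hx hy => simp [hx, hy]

lemma twist_comm (i j : ZMod 2) (x : SAlg ι) :
    twist ι i (twist ι j x) = twist ι j (twist ι i x) := by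
  induction x using psi_induction with
  | h1 c => simp
  | hpsi a => simp [twist_psi, smul_smul, mul_comm]
  | hmul x y hx hy => simp [hx, hy]
  | hadd x y hx hy => simp [hx, hy]

lemma ddx_psi (k : Idx ι) (n : ℕ) : ddx ι (psi k n) = psi k (n + 1) := evenDer_psi _ _ (k, n)

lemma ddx_mul (x y : SAlg ι) : ddx ι (x * y) = ddx ι x * y + x * ddx ι y := evenDer_mul _ _ x y

lemma ddx_algebraMap (c : ℂ) : ddx ι (algebraMap ℂ _ c) = 0 := by
  rw [Algebra.algebraMap_eq_smul_one, map_smul, ddx, evenDer_one, smul_zero]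

lemma ddx_pow_psi (k : Idx ι) (n m : ℕ) : (ddx ι ^ n) (psi k m) = psi k (m + n) := by
  induction n with
  | zero => simp
  | succ n ih => rw [pow_succ', Module.End.mul_apply, ih, ddx_psi, add_assoc]

lemma twist_ddx (i : ZMod 2) (x : SAlg ι) : twist ι i (ddx ι x) = ddx ι (twist ι i x) := by
  induction x using psi_induction with
  | h1 c => simp [ddx_algebraMap]
  | hpsi a => rw [ddx_psi, twist_psi i (a.1, a.2 + 1), twist_psi, map_smul, ddx_psi]
  | hmul x y hx hy => simp [ddx_mul, hx, hy]
  | hadd x y hx hy => simp [hx, hy]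

open Classical in
/-- The algebra map `x ↦ (σ x, ∂ₐ x; 0, x)` into upper triangular matrices, whose upper right
entry is the left super-derivation `∂ₐ`; here `σ` is the `twist` by the parity of `a`. -/
def partialHom (a : Var ι) : SAlg ι →ₐ[ℂ] Matrix (Fin 2) (Fin 2) (SAlg ι) :=
  SAlg.lift (FreeAlgebra.lift ℂ fun b =>
      !![sgn a.1.1 b.1.1 • psi b.1 b.2, if b = a then 1 else 0; 0, psi b.1 b.2]) (by
    rintro x y ⟨b, c⟩
    have h := psi_comm b c
    simp only [map_mul, map_smul, FreeAlgebra.lift_ι_apply]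
    ext i j
    fin_cases i <;> fin_cases j
    · simp only [Matrix.smul_apply]
      simp [Matrix.mul_apply, h, smul_smul, mul_comm, mul_left_comm]
    · by_cases hb : b = a <;> by_cases hc : c = a
      · subst hb; subst hc; simp [Matrix.mul_apply, smul_smul, sgn_mul_self, add_comm]
      · subst hb; simp [Matrix.mul_apply, hc, smul_smul, sgn_mul_self]
      · subst hc; simp [Matrix.mul_apply, hb, sgn_comm b.1.1]
      · simp [Matrix.mul_apply, hb, hc]
    · simp [Matrix.mul_apply]
    · simp [Matrix.mul_apply, h])

lemma partialHom_entries (a : Var ι) (x : SAlg ι) :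
    partialHom a x 0 0 = twist ι a.1.1 x ∧ partialHom a x 1 0 = 0 ∧ partialHom a x 1 1 = x := by
  induction x using psi_induction with
  | h1 c => simp [Matrix.algebraMap_eq_diagonal]
  | hpsi b =>
    rw [twist_psi]
    simp [partialHom, psi, SAlg.lift_mk]
  | hmul x y hx hy => simp [Matrix.mul_apply, hx, hy]
  | hadd x y hx hy => simp [hx, hy]

/-- The left super-derivation `∂ₐ = ∂/∂ψ_{ℓ,j}^{(n)}` of `𝒜`, for `a = ((ℓ, j), n)`. It satisfies
`∂ₐ(x y) = ∂ₐ(x) y + σ(x) ∂ₐ(y)`, where `σ` is the `twist` by the parity of `a`. -/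
def partialDer (a : Var ι) : SAlg ι →ₗ[ℂ] SAlg ι where
  toFun x := partialHom a x 0 1
  map_add' x y := by simp
  map_smul' c x := by simp

lemma partialDer_mul (a : Var ι) (x y : SAlg ι) :
    partialDer a (x * y) = partialDer a x * y + twist ι a.1.1 x * partialDer a y := by
  simp [partialDer, Matrix.mul_apply, partialHom_entries, add_comm]

lemma partialDer_algebraMap (a : Var ι) (c : ℂ) : partialDer a (algebraMap ℂ _ c) = 0 := by
  simp [partialDer, Matrix.algebraMap_eq_diagonal]

lemma partialDer_psi_self (k : Idx ι) (n : ℕ) : partialDer (k, n) (psi k n) = 1 := by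
  simp [partialDer, partialHom, psi, SAlg.lift_mk]

lemma partialDer_psi_of_ne {a : Var ι} {k : Idx ι} {n : ℕ} (h : (k, n) ≠ a) :
    partialDer a (psi k n) = 0 := by
  simp [partialDer, partialHom, psi, SAlg.lift_mk, h]

lemma partialDer_twist (a : Var ι) (i : ZMod 2) (x : SAlg ι) :
    partialDer a (twist ι i x) = sgn i a.1.1 • twist ι i (partialDer a x) := by
  induction x using psi_induction with
  | h1 c => simp [partialDer_algebraMap]
  | hpsi b =>
    rw [twist_psi, map_smul]
    by_cases h : (b.1, b.2) = a
    · subst h; simp [partialDer_psi_self b.1 b.2]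
    · simp [partialDer_psi_of_ne h]
  | hmul x y hx hy =>
    simp [partialDer_mul, hx, hy, twist_comm i]
  | hadd x y hx hy => simp [hx, hy]

lemma partialDer_comm (a b : Var ι) (x : SAlg ι) :
    partialDer a (partialDer b x) = sgn a.1.1 b.1.1 • partialDer b (partialDer a x) := by
  induction x using psi_induction with
  | h1 c => simp [partialDer_algebraMap]
  | hpsi c =>
    have h (d e : Var ι) : partialDer e (partialDer d (psi c.1 c.2)) = 0 := by
      have h1 : partialDer e (1 : SAlg ι) = 0 := by simpa using partialDer_algebraMap e 1
      by_cases h : (c.1, c.2) = d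
      · subst h; simp [partialDer_psi_self c.1 c.2, h1]
      · simp [partialDer_psi_of_ne h]
    simp [h]
  | hmul x y hx hy =>
    simp only [partialDer_mul, map_add, partialDer_twist, hx, hy, twist_comm b.1.1, smul_add,
      smul_mul_assoc, mul_smul_comm, smul_smul, sgn_comm b.1.1, sgn_mul_self, one_smul]
    abel
  | hadd x y hx hy => simp [hx, hy]

lemma partialDer_sq_of_odd {a : Var ι} (ha : a.1.1 = 1) (x : SAlg ι) :
    partialDer a (partialDer a x) = 0 := by
  have h := partialDer_comm a a x
  rw [ha, sgn_self_one, neg_one_smul] at h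
  exact eq_zero_of_eq_neg h

lemma partialDer_succ_ddx (k : Idx ι) (n : ℕ) (x : SAlg ι) :
    partialDer (k, n + 1) (ddx ι x) = ddx ι (partialDer (k, n + 1) x) + partialDer (k, n) x := by
  induction x using psi_induction with
  | h1 c => simp [partialDer_algebraMap, ddx_algebraMap]
  | hpsi b =>
    have h1 : ddx ι (1 : SAlg ι) = 0 := by simpa using ddx_algebraMap (ι := ι) 1
    rw [ddx_psi]
    have h2 : ddx ι (partialDer (k, n + 1) (psi b.1 b.2)) = 0 := by
      by_cases h : (b.1, b.2) = (k, n + 1)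
      · obtain ⟨rfl, hn⟩ := Prod.mk.inj h
        rw [hn, partialDer_psi_self, h1]
      · simp [partialDer_psi_of_ne h]
    rw [h2, zero_add]
    by_cases h : (b.1, b.2) = (k, n)
    · obtain ⟨rfl, hn⟩ := Prod.mk.inj h
      rw [hn, partialDer_psi_self, partialDer_psi_self]
    · rw [partialDer_psi_of_ne h, partialDer_psi_of_ne]
      simpa [Prod.ext_iff] using h
  | hmul x y hx hy =>
    simp only [ddx_mul, map_add, partialDer_mul, hx, hy, twist_ddx, mul_add, add_mul]
    abel
  | hadd x y hx hy => simp only [map_add, hx, hy]; abel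

/-- Every element of `𝒜` involves only variables of bounded order of differentiation. -/
lemma exists_order (x : SAlg ι) : ∃ q, ∀ k n, q ≤ n → partialDer (k, n) x = 0 := by
  induction x using psi_induction with
  | h1 c => exact ⟨0, fun k n _ => partialDer_algebraMap _ c⟩
  | hpsi b =>
    refine ⟨b.2 + 1, fun k n h => partialDer_psi_of_ne fun h' => ?_⟩
    have := (Prod.mk.inj h').2
    omega
  | hmul x y hx hy =>
    obtain ⟨p, hp⟩ := hx
    obtain ⟨q, hq⟩ := hy
    refine ⟨max p q, fun k n h => ?_⟩
    rw [partialDer_mul, hp k n (le_of_max_le_left h), hq k n (le_of_max_le_right h)]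
    simp
  | hadd x y hx hy =>
    obtain ⟨p, hp⟩ := hx
    obtain ⟨q, hq⟩ := hy
    refine ⟨max p q, fun k n h => ?_⟩
    rw [map_add, hp k n (le_of_max_le_left h), hq k n (le_of_max_le_right h), add_zero]

lemma exists_order_finset {α : Type*} (s : Finset α) (x : α → SAlg ι) :
    ∃ q, ∀ i ∈ s, ∀ k n, q ≤ n → partialDer (k, n) (x i) = 0 := by
  choose q hq using fun i => exists_order (x i)
  exact ⟨s.sup q, fun i hi k n h => hq i k n ((Finset.le_sup hi).trans h)⟩

/-- The derivative `d/dx` raises the order: if `w'` has order at most `p`, then `w` has order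
less than `p`. -/
lemma partialDer_eq_zero_of_ddx {p : ℕ} {w : SAlg ι}
    (h : ∀ k n, p + 1 ≤ n → partialDer (k, n) (ddx ι w) = 0) (k : Idx ι) (n : ℕ) (hn : p ≤ n) :
    partialDer (k, n) w = 0 := by
  obtain ⟨q, hq⟩ := exists_order w
  have key : ∀ j n, p ≤ n → q ≤ n + j → partialDer (k, n) w = 0 := by
    intro j
    induction j with
    | zero => exact fun n _ hn => hq k n hn
    | succ j ih =>
      intro n hp hn
      have h1 := partialDer_succ_ddx k n w
      rwa [h k (n + 1) (by omega), ih (n + 1) (by omega) (by omega), map_zero, zero_add,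
        eq_comm] at h1
  exact key q n hn (by omega)

/-- Non-degeneracy of the pairing `(x, y) ↦ (x y)~`. A total derivative `w'` is linear in the
variables of top order, with coefficients that are the derivatives of one function `w`. Multiplying
`x` by `(ψ^{(n)})²` in the even case, or by `ψ^{(n+2)} ψ^{(n+1)} ψ^{(n)}` in the odd case, for large
`n`, therefore gives a total derivative only if `x = 0`. -/
theorem eq_zero_of_mul_mem_range_ddx (k : Idx ι) {x : SAlg ι}
    (h : ∀ y ∈ homog ι k.1, x * y ∈ LinearMap.range (ddx ι)) : x = 0 := by
  obtain ⟨p, hp⟩ := exists_order x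
  -- If `x y = w'` and `y` has order at most `q + 1`, then `w` has order at most `q`, and its
  -- derivative by `ψ_k^{(q)}` is the coefficient of `ψ_k^{(q+1)}` in `w'`.
  have key (y : SAlg ι) (w : SAlg ι) (hw : ddx ι w = x * y) (q : ℕ) (hpq : p ≤ q)
      (hy : ∀ j n, q + 2 ≤ n → partialDer (j, n) y = 0) :
      (∀ j n, q + 1 ≤ n → partialDer (j, n) w = 0) ∧
      partialDer (k, q) w = twist ι k.1 x * partialDer (k, q + 1) y := by
    have h1 : ∀ j n, q + 1 ≤ n → partialDer (j, n) w = 0 := by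
      refine partialDer_eq_zero_of_ddx fun j n hn => ?_
      rw [hw, partialDer_mul, hp j n (by omega), hy j n (by omega)]
      simp
    refine ⟨h1, ?_⟩
    have h2 := partialDer_succ_ddx k q w
    rw [h1 k (q + 1) le_rfl, map_zero, zero_add, hw, partialDer_mul, hp k _ (by omega),
      zero_mul, zero_add] at h2
    exact h2.symm
  have hne (m n : ℕ) (hmn : m ≠ n) (j i : Idx ι) : partialDer (j, n) (psi i m) = 0 :=
    partialDer_psi_of_ne fun h => hmn (Prod.mk.inj h).2
  have cases2 : ∀ i : ZMod 2, i = 0 ∨ i = 1 := by decide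
  rcases cases2 k.1 with hk | hk
  · obtain ⟨w, hw⟩ := h (psi k (p + 1) * psi k (p + 1)) (by
      have := mul_mem_homog (psi_mem k (p + 1)) (psi_mem k (p + 1))
      rw [hk] at this ⊢
      simpa using this)
    obtain ⟨h1, h2⟩ := key _ w hw p le_rfl (fun j n hn => by
      rw [partialDer_mul, hne _ _ (by omega)]; simp)
    -- `∂w/∂ψ_k^{(p)}` has no terms in `ψ_k^{(p+1)}`, but it is equal to `2 x ψ_k^{(p+1)}`.
    have h3 : partialDer (k, p + 1) (partialDer (k, p) w) = 0 := by
      rw [partialDer_comm, h1 k _ le_rfl, map_zero, smul_zero]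
    simp only [h2, hk, twist_zero, partialDer_mul, partialDer_psi_self, map_add, one_mul, mul_one,
      hp k (p + 1) (by omega), zero_mul, zero_add] at h3
    exact eq_zero_of_eq_neg (eq_neg_of_add_eq_zero_left (by simpa [mul_add] using h3))
  · obtain ⟨w, hw⟩ := h (psi k (p + 2) * psi k (p + 1) * psi k p) (by
      have := mul_mem_homog (mul_mem_homog (psi_mem k (p + 2)) (psi_mem k (p + 1))) (psi_mem k p)
      rwa [add_assoc, CharTwo.add_self_eq_zero, add_zero] at this)
    obtain ⟨h1, h2⟩ := key _ w hw (p + 1) (by omega) (fun j n hn => by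
      simp only [partialDer_mul, hne _ n (show p + 2 ≠ n by omega),
        hne _ n (show p + 1 ≠ n by omega), hne _ n (show p ≠ n by omega)]
      simp)
    -- An odd super-derivation has square zero.
    have h3 := partialDer_sq_of_odd (a := (k, p + 1)) hk w
    simp only [h2, partialDer_mul, partialDer_psi_self, partialDer_twist, twist_twist,
      hp k (p + 1) (by omega), hne p (p + 2) (by omega), hne (p + 1) (p + 2) (by omega),
      hne p (p + 1) (by omega), map_zero, smul_zero, mul_zero, zero_mul, zero_add, add_zero,
      one_mul] at h3
    have h4 := congrArg (partialDer (k, p)) h3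
    simp only [partialDer_mul, hp k p le_rfl, partialDer_psi_self, zero_mul, zero_add, mul_one,
      map_zero] at h4
    simpa using (congrArg (twist ι k.1) h4).symm.trans (twist_twist _ x) |>.symm

/-- Products with fresh variables `ψ_k^{(N+n)}`, not involved in the left factors, are linearly
independent. -/
lemma eq_zero_of_sum_mul_psi (k : Idx ι) (N : ℕ) (s : Finset ℕ) (x : ℕ → SAlg ι)
    (hx : ∀ i ∈ s, ∀ n, N ≤ n → partialDer (k, n) (x i) = 0)
    (h : ∑ i ∈ s, x i * psi k (N + i) = 0) {i : ℕ} (hi : i ∈ s) : x i = 0 := by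
  have h1 := congrArg (partialDer (k, N + i)) h
  rw [map_sum, Finset.sum_eq_single_of_mem i hi] at h1
  · rw [partialDer_mul, hx i hi _ (by omega), partialDer_psi_self, zero_mul, zero_add, mul_one,
      map_zero] at h1
    rw [← twist_twist k.1 (x i), h1, map_zero]
  · intro j hj hji
    rw [partialDer_mul, hx j hj _ (by omega), partialDer_psi_of_ne, mul_zero, zero_mul, add_zero]
    intro h'
    have := (Prod.mk.inj h').2
    omega

/-- The Leibniz rule for `(d/dx)^n`. -/
lemma ddx_pow_mul (n : ℕ) (x y : SAlg ι) :
    (ddx ι ^ n) (x * y) = ∑ ij ∈ Finset.HasAntidiagonal.antidiagonal n,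
      n.choose ij.1 • ((ddx ι ^ ij.1) x * (ddx ι ^ ij.2) y) := by
  induction n with
  | zero => simp
  | succ n ih =>
    rw [Finset.sum_antidiagonal_choose_succ_nsmul
      (fun i j => (ddx ι ^ i) x * (ddx ι ^ j) y), pow_succ', Module.End.mul_apply, ih, map_sum,
      ← Finset.sum_add_distrib]
    refine Finset.sum_congr rfl fun ij hij => ?_
    rw [map_nsmul, ddx_mul, smul_add, add_comm, pow_succ', pow_succ', Module.End.mul_apply,
      Module.End.mul_apply,
      ← Nat.choose_symm_of_eq_add (Finset.HasAntidiagonal.mem_antidiagonal.1 hij).symm]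

lemma tilde_ddx (x : SAlg ι) : tilde (ddx ι x) = 0 :=
  (Submodule.Quotient.mk_eq_zero _).2 ⟨x, rfl⟩

/-- Integration by parts in `𝒜̃`. -/
lemma tilde_ddx_pow_mul (n : ℕ) (x y : SAlg ι) :
    tilde ((ddx ι ^ n) x * y) = tilde (x * ((-ddx ι) ^ n) y) := by
  induction n generalizing y with
  | zero => simp
  | succ n ih =>
    have h := tilde_ddx ((ddx ι ^ n) x * y)
    rw [ddx_mul, map_add, ih] at h
    rw [pow_succ', Module.End.mul_apply, pow_succ, Module.End.mul_apply, LinearMap.neg_apply,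
      map_neg, mul_neg, map_neg]
    exact eq_neg_of_add_eq_zero_left h

end SuperDerivations

/-! ### Hamiltonian operators and the closedness condition -/

section Closedness

variable {ι : ZMod 2 → Type*}

lemma der_psi (ξ : GBar ι) (k : Idx ι) (n : ℕ) : der ξ (psi k n) = (ddx ι ^ n) (ξ.1 k) :=
  evenDer_psi _ _ (k, n)

lemma der_mul (ξ : GBar ι) (x y : SAlg ι) : der ξ (x * y) = der ξ x * y + x * der ξ y :=
  evenDer_mul _ _ x y

lemma der_algebraMap (ξ : GBar ι) (c : ℂ) : der ξ (algebraMap ℂ _ c) = 0 := by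
  rw [Algebra.algebraMap_eq_smul_one, map_smul, der, evenDer_one, smul_zero]

lemma der_ddx_pow (ξ : GBar ι) (n : ℕ) (x : SAlg ι) :
    der ξ ((ddx ι ^ n) x) = (ddx ι ^ n) (der ξ x) := by
  induction n with
  | zero => simp
  | succ n ih => simp only [pow_succ', Module.End.mul_apply, der_ddx, ih]

lemma der_add (ξ η : GBar ι) (x : SAlg ι) : der (ξ + η) x = der ξ x + der η x := by
  induction x using psi_induction with
  | h1 c => simp [der_algebraMap]
  | hpsi a => simp [der_psi]
  | hmul x y hx hy => simp only [der_mul, hx, hy, add_mul, mul_add]; abel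
  | hadd x y hx hy => simp only [map_add, hx, hy]; abel

lemma der_mem (ξ : GBar ι) {i : ZMod 2} {x : SAlg ι} (hx : x ∈ homog ι i) :
    der ξ x ∈ homog ι i := evenDer_mem _ _ hx

lemma pair_val (u : Omega ι) (ξ : GBar ι) :
    (pair u ξ).1 = tilde (u.1.sum fun k f => ξ.1 k * f) := rfl

lemma pair_add_left (u v : Omega ι) (ξ : GBar ι) : pair (u + v) ξ = pair u ξ + pair v ξ := by
  ext
  simp only [pair_val, Submodule.coe_add]
  rw [Finsupp.sum_add_index' (by simp) (fun k => mul_add _), map_add]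

lemma pair_add_right (u : Omega ι) (ξ η : GBar ι) : pair u (ξ + η) = pair u ξ + pair u η := by
  ext
  simp only [pair_val, Submodule.coe_add, Pi.add_apply, add_mul, Finsupp.sum_add, map_add]

lemma pair_smul_left (c : ℂ) (u : Omega ι) (ξ : GBar ι) : pair (c • u) ξ = c • pair u ξ := by
  ext
  simp only [pair_val, Submodule.coe_smul]
  rw [Finsupp.sum_smul_index' (by simp), Finsupp.sum, Finsupp.sum, ← map_smul, Finset.smul_sum]
  simp

lemma pair_smul_right (c : ℂ) (u : Omega ι) (ξ : GBar ι) : pair u (c • ξ) = c • pair u ξ := by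
  ext
  simp only [pair_val, Submodule.coe_smul, Pi.smul_apply, smul_mul_assoc]
  rw [Finsupp.sum, Finsupp.sum, ← map_smul, Finset.smul_sum]

/-- The pairing `(u, ξ) ↦ u(ξ)` of 1-forms with vector fields as a bilinear map. -/
def pairing (ι : ZMod 2 → Type*) : Omega ι →ₗ[ℂ] GBar ι →ₗ[ℂ] ATilde₀ ι :=
  LinearMap.mk₂ ℂ pair pair_add_left pair_smul_left pair_add_right pair_smul_right

/-- The derivative `∂_ξ(u)` of `u ∈ Ω₀`, componentwise. -/
def derOmega (ξ : GBar ι) (u : Omega ι) : Omega ι :=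
  ⟨u.1.mapRange (der ξ) (map_zero _), fun k _ => by
    simpa using der_mem ξ (omega_mem u k)⟩

/-- The derivative `∂_ξ(η)` of `η ∈ 𝒢̄₀`, componentwise. -/
def derG (ξ : GBar ι) (η : GBar ι) : GBar ι :=
  ⟨fun k => der ξ (η.1 k), fun k _ => der_mem ξ (gBar_mem η k)⟩

lemma bracket_eq (ξ η : GBar ι) : bracket ξ η = derG ξ η - derG η ξ := rfl

lemma derOmega_sum {M : Type*} [AddCommMonoid M] (ξ : GBar ι) (u : Omega ι)
    (g : Idx ι → SAlg ι → M) (hg : ∀ k, g k 0 = 0) :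
    (derOmega ξ u).1.sum g = u.1.sum fun k f => g k (der ξ f) :=
  Finsupp.sum_mapRange_index (hf := map_zero (der ξ)) hg

lemma act₀_pair (ξ : GBar ι) (u : Omega ι) (η : GBar ι) :
    act₀ ξ (pair u η) = pair (derOmega ξ u) η + pair u (derG ξ η) := by
  ext
  change tilde (der ξ (u.1.sum fun k f => η.1 k * f)) = tilde _ + tilde _
  have h : (derOmega ξ u).1.sum (fun k f => η.1 k * f) = u.1.sum fun k f => η.1 k * der ξ f :=
    derOmega_sum ξ u _ (by simp)
  change _ = tilde ((derOmega ξ u).1.sum fun k f => η.1 k * f) +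
    tilde (u.1.sum fun k f => der ξ (η.1 k) * f)
  rw [h, ← map_add, ← Finsupp.sum_add, Finsupp.sum, map_sum]
  congr 1
  refine Finset.sum_congr rfl fun k _ => ?_
  rw [der_mul, add_comm]

namespace MatDiffOp

lemma diffOp_apply (a : ℕ →₀ SAlg ι) (f : SAlg ι) :
    diffOp a f = a.sum fun n x => x * (ddx ι ^ n) f := by
  simp [diffOp, LinearMap.sum_apply, Finsupp.sum]

lemma toLin_apply (H : MatDiffOp ι) (v : Omega ι) (r : Idx ι) :
    (H.toLin v).1 r = v.1.sum fun c f => diffOp (H.coeff r c) f := by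
  rfl

lemma derApply_apply (H : MatDiffOp ι) (ξ : GBar ι) (v : Omega ι) (r : Idx ι) :
    (H.derApply ξ v).1 r = v.1.sum fun c f =>
      (H.coeff r c).sum fun m x => der ξ x * (ddx ι ^ m) f := rfl

lemma derApply_add_left (H : MatDiffOp ι) (ξ η : GBar ι) (v : Omega ι) :
    H.derApply (ξ + η) v = H.derApply ξ v + H.derApply η v := by
  ext r
  simp only [Submodule.coe_add, Pi.add_apply, derApply_apply, der_add, add_mul, Finsupp.sum_add]

lemma derApply_add_right (H : MatDiffOp ι) (ξ : GBar ι) (v w : Omega ι) :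
    H.derApply ξ (v + w) = H.derApply ξ v + H.derApply ξ w := by
  ext r
  simp only [Submodule.coe_add, Pi.add_apply, derApply_apply]
  exact Finsupp.sum_add_index' (by simp) fun c f g => by
    simp only [map_add, mul_add, Finsupp.sum_add]

lemma derApply_zero_left (H : MatDiffOp ι) (v : Omega ι) : H.derApply 0 v = 0 := by
  have h := H.derApply_add_left 0 0 v
  rwa [add_zero, left_eq_add] at h

lemma derApply_zero_right (H : MatDiffOp ι) (ξ : GBar ι) : H.derApply ξ 0 = 0 := by
  have h := H.derApply_add_right ξ 0 0
  rwa [add_zero, left_eq_add] at h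

/-- `∂_ξ(H v) = ∂_ξ(H)(v) + H(∂_ξ v)`. -/
lemma derG_toLin (H : MatDiffOp ι) (ξ : GBar ι) (v : Omega ι) :
    derG ξ (H.toLin v) = H.derApply ξ v + H.toLin (derOmega ξ v) := by
  ext r
  simp only [Submodule.coe_add, Pi.add_apply]
  change der ξ ((H.toLin v).1 r) = _
  have h : (H.toLin (derOmega ξ v)).1 r = v.1.sum fun c f => diffOp (H.coeff r c) (der ξ f) := by
    rw [toLin_apply]
    exact derOmega_sum ξ v _ (by simp)
  rw [toLin_apply, derApply_apply, h, ← Finsupp.sum_add, Finsupp.sum, map_sum]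
  refine Finset.sum_congr rfl fun c _ => ?_
  change _ = Finsupp.sum _ _ + diffOp _ _
  rw [diffOp_apply, diffOp_apply, ← Finsupp.sum_add, Finsupp.sum, map_sum]
  refine Finset.sum_congr rfl fun m _ => ?_
  rw [der_mul, der_ddx_pow]

/-- If `H` is skew-symmetric, then so is each `∂_ξ(H)`. -/
lemma pair_derApply_skew (H : MatDiffOp ι) (hH : IsSkew H.toLin) (ξ : GBar ι) (u v : Omega ι) :
    pair u (H.derApply ξ v) = -pair v (H.derApply ξ u) := by
  have h := congrArg (act₀ ξ) (hH u v)
  rw [map_neg, act₀_pair, act₀_pair, derG_toLin, derG_toLin, pair_add_right, pair_add_right,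
    hH (derOmega ξ u) v, hH u (derOmega ξ v)] at h
  have h' : pair u (H.derApply ξ v) + pair v (H.derApply ξ u) = 0 := by
    rw [← sub_eq_zero] at h
    rw [← h]; abel
  exact eq_neg_of_add_eq_zero_left h'

/-- For a skew-symmetric `H`, the differential of `ω_H` at `(Hu₁, Hu₂, Hu₃)` is the cyclic sum in
`Closedness`: all terms in which `H` itself is not differentiated cancel. -/
lemma dTwo_eq (H : MatDiffOp ι) (hH : IsSkew H.toLin)
    (hL : ∀ ξ ∈ LinearMap.range H.toLin, ∀ η ∈ LinearMap.range H.toLin,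
      bracket ξ η ∈ LinearMap.range H.toLin)
    (ω : LinearMap.range H.toLin →ₗ[ℂ] LinearMap.range H.toLin →ₗ[ℂ] ATilde₀ ι)
    (hω : ∀ ξ φ, ω ξ (H.toLin.rangeRestrict φ) = pair φ ξ.1)
    (u₁ u₂ u₃ : Omega ι) :
    dTwo (LinearMap.range H.toLin) hL ω (H.toLin.rangeRestrict u₁) (H.toLin.rangeRestrict u₂)
        (H.toLin.rangeRestrict u₃) =
      pair u₃ (H.derApply (H.toLin u₂) u₁) + pair u₁ (H.derApply (H.toLin u₃) u₂) +
      pair u₂ (H.derApply (H.toLin u₁) u₃) := by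
  have hc (u : Omega ι) : (H.toLin.rangeRestrict u).1 = H.toLin u := rfl
  have hs (u v w : Omega ι) := H.pair_derApply_skew hH (H.toLin u) v w
  have hq (u v : Omega ι) (w : Omega ι) :
      pair (derOmega (H.toLin u) v) (H.toLin w) = -pair w (H.toLin (derOmega (H.toLin u) v)) :=
    hH _ _
  have hsub (u : Omega ι) (ξ η : GBar ι) : pair u (ξ - η) = pair u ξ - pair u η :=
    map_sub (pairing ι u) ξ η
  unfold dTwo
  simp only [hω, hc, act₀_pair, bracket_eq, derG_toLin, hsub, pair_add_right, hq]
  rw [hs u₂ u₁ u₃, hs u₁ u₃ u₂, hs u₃ u₂ u₁]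
  abel

lemma closedness_of_isHamiltonian (H : MatDiffOp ι) (hH : IsHamiltonian H.toLin) :
    H.Closedness := by
  obtain ⟨ω, -, hω, hd⟩ := hH.closed
  intro u₁ u₂ u₃
  rw [← H.dTwo_eq hH.skew hH.subalgebra ω (fun ξ φ => ?_) u₁ u₂ u₃, hd]
  obtain ⟨ψ, rfl⟩ := LinearMap.surjective_rangeRestrict H.toLin ξ
  exact hω ψ φ

/-- Let `ζ ∈ Ω₀` be the 1-form `ξ ↦ u₂(∂_ξ(H)(u₁))`. For a skew-symmetric `H`, pairing
`∂_{Hu₁}(H)(u₂) - ∂_{Hu₂}(H)(u₁) - Hζ` with `u₃` gives the cyclic sum in `Closedness`, up to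
sign. -/
lemma pair_derApply_sub (H : MatDiffOp ι) (hH : IsSkew H.toLin) (u₁ u₂ u₃ ζ : Omega ι)
    (hζ : ∀ ξ, pair ζ ξ = pair u₂ (H.derApply ξ u₁)) :
    pair u₃ (H.derApply (H.toLin u₁) u₂ - H.derApply (H.toLin u₂) u₁ - H.toLin ζ) =
      -(pair u₃ (H.derApply (H.toLin u₂) u₁) + pair u₁ (H.derApply (H.toLin u₃) u₂) +
      pair u₂ (H.derApply (H.toLin u₁) u₃)) := by
  have hsub (u : Omega ι) (ξ η : GBar ι) : pair u (ξ - η) = pair u ξ - pair u η :=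
    map_sub (pairing ι u) ξ η
  rw [hsub, hsub, hH u₃ ζ, hζ, H.pair_derApply_skew hH (H.toLin u₁) u₃ u₂,
    H.pair_derApply_skew hH (H.toLin u₃) u₂ u₁]
  abel

/-- If `H` is skew-symmetric and `[Hu₁, Hu₂] = H(∂_{Hu₁}(u₂) - ∂_{Hu₂}(u₁) + ζ)` for the 1-form
`ζ : ξ ↦ u₂(∂_ξ(H)(u₁))`, then `H` satisfies the closedness condition and is Hamiltonian. -/
theorem isHamiltonian_of_skew (H : MatDiffOp ι) (hH : IsSkew H.toLin)
    (h : ∀ u₁ u₂ : Omega ι, ∃ ζ : Omega ι, (∀ ξ, pair ζ ξ = pair u₂ (H.derApply ξ u₁)) ∧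
      H.derApply (H.toLin u₁) u₂ - H.derApply (H.toLin u₂) u₁ - H.toLin ζ = 0) :
    H.Closedness ∧ IsHamiltonian H.toLin := by
  have hcl : H.Closedness := by
    intro u₁ u₂ u₃
    obtain ⟨ζ, hζ, h0⟩ := h u₁ u₂
    have h1 := H.pair_derApply_sub hH u₁ u₂ u₃ ζ hζ
    rw [h0, show pair u₃ 0 = 0 from map_zero (pairing ι u₃)] at h1
    exact neg_eq_zero.1 h1.symm
  have hL : ∀ ξ ∈ LinearMap.range H.toLin, ∀ η ∈ LinearMap.range H.toLin,
      bracket ξ η ∈ LinearMap.range H.toLin := by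
    rintro _ ⟨u₁, rfl⟩ _ ⟨u₂, rfl⟩
    obtain ⟨ζ, -, h0⟩ := h u₁ u₂
    refine ⟨derOmega (H.toLin u₁) u₂ - derOmega (H.toLin u₂) u₁ + ζ, ?_⟩
    rw [map_add, map_sub H.toLin _ _, ← sub_eq_zero.1 h0, bracket_eq, derG_toLin, derG_toLin]
    abel
  refine ⟨hcl, hH, hL, ?_⟩
  -- `ω_H(ξ, η)` is the value at `ξ` of any preimage of `η`, by skew-symmetry.
  have : Module.Free ℂ (LinearMap.range H.toLin) :=
    Module.Free.of_divisionRing ℂ (LinearMap.range H.toLin)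
  obtain ⟨s, hs⟩ := H.toLin.rangeRestrict.exists_rightInverse_of_surjective
    H.toLin.range_rangeRestrict
  have hs' (η : LinearMap.range H.toLin) : H.toLin (s η) = η.1 :=
    congrArg Subtype.val (LinearMap.congr_fun hs η)
  let ω : LinearMap.range H.toLin →ₗ[ℂ] LinearMap.range H.toLin →ₗ[ℂ] ATilde₀ ι :=
    ((pairing ι).comp s).flip.comp (LinearMap.range H.toLin).subtype
  have hω (ξ : LinearMap.range H.toLin) (φ : Omega ι) :
      ω ξ (H.toLin.rangeRestrict φ) = pair φ ξ.1 := by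
    obtain ⟨ψ, rfl⟩ := LinearMap.surjective_rangeRestrict H.toLin ξ
    change pair (s _) (H.toLin ψ) = pair φ (H.toLin ψ)
    rw [hH, hs', hH φ ψ]
    rfl
  refine ⟨ω, fun ξ η => ?_, fun φ₁ φ₂ => hω _ _, fun ξ₁ ξ₂ ξ₃ => ?_⟩
  · obtain ⟨φ, rfl⟩ := LinearMap.surjective_rangeRestrict H.toLin ξ
    obtain ⟨ψ, rfl⟩ := LinearMap.surjective_rangeRestrict H.toLin η
    rw [hω, hω]
    exact hH _ _
  · obtain ⟨u₁, rfl⟩ := LinearMap.surjective_rangeRestrict H.toLin ξ₁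
    obtain ⟨u₂, rfl⟩ := LinearMap.surjective_rangeRestrict H.toLin ξ₂
    obtain ⟨u₃, rfl⟩ := LinearMap.surjective_rangeRestrict H.toLin ξ₃
    rw [H.dTwo_eq hH hL ω hω, hcl]

end MatDiffOp

/-- The element of `Ω₀` with the single component `f ∈ 𝒜_ℓ` at the index `c = (ℓ, j)`. -/
def single (c : Idx ι) (f : SAlg ι) (hf : f ∈ homog ι c.1) : Omega ι :=
  ⟨Finsupp.single c f, fun k _ => by
    classical
    by_cases h : c = k
    · subst h; simpa using hf
    · simp [Finsupp.single_eq_of_ne' h]⟩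

lemma omega_induction {p : Omega ι → Prop} (h0 : p 0) (hadd : ∀ u v, p u → p v → p (u + v))
    (hsingle : ∀ c f hf, p (single c f hf)) (u : Omega ι) : p u := by
  classical
  have key : ∀ s : Finset (Idx ι), ∀ u : Omega ι, u.1.support ⊆ s → p u := by
    intro s
    induction s using Finset.induction_on with
    | empty =>
      intro u hu
      have : u = 0 := Subtype.ext (Finsupp.support_eq_empty.1 (Finset.subset_empty.1 hu))
      rwa [this]
    | insert c s hc ih =>
      intro u hu
      have h : u = single c (u.1 c) (omega_mem u c) +
          ⟨u.1.erase c, fun k _ => by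
            by_cases h : k = c
            · simp [h]
            · simpa [Finsupp.erase_ne h] using omega_mem u k⟩ :=
        Subtype.ext (Finsupp.single_add_erase c u.1).symm
      rw [h]
      refine hadd _ _ (hsingle _ _ _) (ih _ fun k hk => ?_)
      rw [Finsupp.support_erase, Finset.mem_erase] at hk
      exact (Finset.mem_insert.1 (hu hk.2)).resolve_left hk.1
  exact key _ u subset_rfl

end Closedness

/-! ### Formal calculus in `R[z⁻¹]z⁻¹` -/

section FormalCalculus

variable {ι : ZMod 2 → Type*} {R : Type*} [AddCommGroup R] [Module ℂ R] [Module ℂ[X] R]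
  [IsScalarTower ℂ ℂ[X] R]

lemma del_apply (a : R) : del R a = (X : ℂ[X]) • a := rfl

lemma del_pow_apply (n : ℕ) (a : R) : (del R ^ n) a = (X ^ n : ℂ[X]) • a := by
  induction n with
  | zero => simp
  | succ n ih => rw [pow_succ', Module.End.mul_apply, ih, del_apply, pow_succ', mul_smul]

lemma ddz_single (m : ℕ) (a : R) :
    ddz R (Finsupp.single m a) = -((m : ℂ) + 1) • Finsupp.single (m + 1) a := by
  rw [ddz, Finsupp.lsum_single]
  rfl

/-- For `n = 0` the truncated index `n - 1` is harmless, since the coefficient is zero. -/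
lemma ddz_apply (F : Polar R) (n : ℕ) : ddz R F n = -(n : ℂ) • F (n - 1) := by
  induction F using Finsupp.induction_linear with
  | zero => simp
  | add F G hF hG => simp only [map_add, Finsupp.add_apply, hF, hG, smul_add]
  | single m a =>
    rw [ddz_single, Finsupp.smul_apply]
    rcases n with _ | n
    · simp
    · by_cases h : m = n
      · subst h; simp
      · simp [h]

lemma delCoeff_apply (F : Polar R) (n : ℕ) : delCoeff R F n = del R (F n) := by
  simp [delCoeff]

lemma delCoeff_single (m : ℕ) (a : R) :
    delCoeff R (Finsupp.single m a) = Finsupp.single m (del R a) := by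
  simp [delCoeff]

lemma delCoeff_ddz (F : Polar R) : delCoeff R (ddz R F) = ddz R (delCoeff R F) := by
  ext n
  simp [delCoeff_apply, ddz_apply]

/-- The map `f(z) ↦ Res_x e^{x∂} f(-x) / (z - x)` on `R[z⁻¹]z⁻¹`. -/
def skewMap (R : Type*) [AddCommGroup R] [Module ℂ R] [Module ℂ[X] R] [IsScalarTower ℂ ℂ[X] R] :
    Polar R →ₗ[ℂ] Polar R :=
  Finsupp.lsum ℂ fun m => ∑ l ∈ Finset.range (m + 1),
    Finsupp.lsingle l ∘ₗ (((-1 : ℂ) ^ (m + 1) * ((m - l).factorial : ℂ)⁻¹) • del R ^ (m - l))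

lemma skewMap_single (m : ℕ) (a : R) :
    skewMap R (Finsupp.single m a) = ∑ l ∈ Finset.range (m + 1), Finsupp.single l
      (((-1 : ℂ) ^ (m + 1) * ((m - l).factorial : ℂ)⁻¹) • (del R ^ (m - l)) a) := by
  simp [skewMap]

lemma skewMap_single_apply (m : ℕ) (a : R) (l : ℕ) :
    skewMap R (Finsupp.single m a) l = if l ≤ m then
      ((-1 : ℂ) ^ (m + 1) * ((m - l).factorial : ℂ)⁻¹) • (del R ^ (m - l)) a else 0 := by
  rw [skewMap_single, Finset.sum_apply']
  simp [Finsupp.single_apply]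

lemma skewCoeff_eq (F : Polar R) (l : ℕ) : skewCoeff F l = skewMap R F l := by
  induction F using Finsupp.induction_linear with
  | zero => simp [skewCoeff]
  | add F G hF hG =>
    rw [map_add, Finsupp.add_apply, ← hF, ← hG, skewCoeff, Finsupp.sum_add_index']
    · rfl
    · simp
    · intro m a a'
      split_ifs <;> simp
  | single m a =>
    rw [skewMap_single_apply, skewCoeff, Finsupp.sum_single_index (by simp)]

lemma skewMap_delCoeff (F : Polar R) : skewMap R (delCoeff R F) = delCoeff R (skewMap R F) := by
  induction F using Finsupp.induction_linear with
  | zero => simp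
  | add F G hF hG => simp only [map_add, hF, hG]
  | single m a =>
    ext l
    rw [delCoeff_single, delCoeff_apply, skewMap_single_apply, skewMap_single_apply,
      apply_ite (del R), map_zero, map_smul, ← Module.End.mul_apply, ← Module.End.mul_apply,
      (Commute.refl _).pow_left]

lemma skewMap_ddz (F : Polar R) :
    skewMap R (ddz R F) = delCoeff R (skewMap R F) - ddz R (skewMap R F) := by
  induction F using Finsupp.induction_linear with
  | zero => simp
  | add F G hF hG => simp only [map_add, hF, hG]; abel
  | single m a =>
    ext l
    rw [ddz_single, map_smul, Finsupp.smul_apply, Finsupp.sub_apply, delCoeff_apply, ddz_apply]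
    simp only [skewMap_single_apply]
    have hd (k : ℕ) : del R ((del R ^ k) a) = (del R ^ (k + 1)) a := by
      rw [pow_succ', Module.End.mul_apply]
    rcases l with _ | l
    · simp only [zero_le, if_true, map_smul, hd, smul_smul, Nat.sub_zero, Nat.cast_zero, neg_zero,
        zero_smul, sub_zero]
      congr 1
      rw [Nat.factorial_succ, Nat.cast_mul]
      have h1 : (m.factorial : ℂ) ≠ 0 := Nat.cast_ne_zero.2 m.factorial_ne_zero
      have h2 : ((m + 1 : ℕ) : ℂ) ≠ 0 := Nat.cast_ne_zero.2 m.succ_ne_zero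
      field_simp
      push_cast
      ring
    · rw [Nat.add_sub_cancel]
      rcases lt_trichotomy l m with h | h | h
      · obtain ⟨k, rfl⟩ := Nat.exists_eq_add_of_lt h
        rw [if_pos (by omega), if_pos (by omega), if_pos (by omega),
          show l + k + 1 + 1 - (l + 1) = k + 1 by omega, show l + k + 1 - (l + 1) = k by omega,
          show l + k + 1 - l = k + 1 by omega, map_smul, hd, smul_smul, smul_smul, ← sub_smul]
        congr 1
        rw [Nat.factorial_succ, Nat.cast_mul]
        have h1 : (k.factorial : ℂ) ≠ 0 := Nat.cast_ne_zero.2 k.factorial_ne_zero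
        have h2 : ((k + 1 : ℕ) : ℂ) ≠ 0 := Nat.cast_ne_zero.2 k.succ_ne_zero
        field_simp
        push_cast
        ring
      · subst h
        simp [smul_smul, pow_succ]
      · rw [if_neg (by omega), if_neg (by omega), if_neg (by omega)]
        simp

/-! ### Sesquilinear products and the Jacobi identity -/

/-- The coefficient of `z₁^{-a-1} z₂^{-c-1}` in the right-hand side of the Jacobi identity, as a
sum over all `u₍ₘ₎v` with `m ≤ a`. -/
lemma jacobiCoeff_eq (Y : R →ₗ[ℂ] R →ₗ[ℂ] Polar R) (u v w : R) (a c : ℕ) :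
    jacobiCoeff Y u v w a c =
      ∑ m ∈ Finset.range (a + 1), (a.choose m : ℂ) • Y (Y u v m) w (a + c - m) := by
  have h : ∀ m ≤ a, (a.choose (a - m) : ℂ) • Y (Y u v m) w (c + (a - m)) =
      (a.choose m : ℂ) • Y (Y u v m) w (a + c - m) := by
    intro m hm
    rw [Nat.choose_symm hm, show c + (a - m) = a + c - m by omega]
  rw [jacobiCoeff, Finsupp.sum, ← Finset.sum_filter]
  trans ∑ m ∈ Finset.range (a + 1) with m ∈ (Y u v).support,
      (a.choose m : ℂ) • Y (Y u v m) w (a + c - m)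
  · refine Finset.sum_congr ?_ fun m hm => h m ?_
    · ext m
      simp [and_comm]
    · exact Nat.lt_succ_iff.1 (Finset.mem_range.1 (Finset.mem_filter.1 hm).1)
  · refine Finset.sum_filter_of_ne fun m _ hm => ?_
    rw [Finsupp.mem_support_iff]
    rintro h0
    simp [h0] at hm

/-- The rule `Y(u,z) ∂v = (∂ - d/dz) Y(u,z)v`. Together with `Translation` it makes `Y` determined
by its values on generators. -/
def RightTranslation (Y : R →ₗ[ℂ] R →ₗ[ℂ] Polar R) : Prop :=
  ∀ u v, Y u (del R v) = delCoeff R (Y u v) - ddz R (Y u v)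

section Sesquilinear

variable {Y : R →ₗ[ℂ] R →ₗ[ℂ] Polar R}

lemma Translation.apply (hT : Translation Y) (u v : R) (n : ℕ) :
    Y (del R u) v n = -(n : ℂ) • Y u v (n - 1) := by
  rw [del_apply, hT, ddz_apply]

lemma RightTranslation.apply (hT : RightTranslation Y) (u v : R) (n : ℕ) :
    Y u (del R v) n = del R (Y u v n) + (n : ℂ) • Y u v (n - 1) := by
  rw [hT, Finsupp.sub_apply, delCoeff_apply, ddz_apply, neg_smul, sub_neg_eq_add]

lemma jacobiCoeff_del_left (hT : Translation Y) (u v w : R) (a c : ℕ) :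
    jacobiCoeff Y (del R u) v w a c = -(a : ℂ) • jacobiCoeff Y u v w (a - 1) c := by
  simp only [jacobiCoeff_eq, hT.apply, map_smul, LinearMap.smul_apply, Finsupp.smul_apply,
    Finset.smul_sum, smul_smul]
  rcases a with _ | a
  · simp
  · rw [Finset.sum_range_succ']
    simp only [Nat.cast_zero, neg_zero, mul_zero, zero_smul, add_zero, Nat.add_sub_cancel]
    refine Finset.sum_congr rfl fun m _ => ?_
    have h := congrArg (Nat.cast : ℕ → ℂ) (Nat.add_one_mul_choose_eq a m)
    rw [show a + 1 + c - (m + 1) = a + c - m by omega]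
    congr 1
    push_cast at h ⊢
    linear_combination h

lemma jacobiCoeff_del_middle (hT : Translation Y) (hT' : RightTranslation Y) (u v w : R)
    (a c : ℕ) :
    jacobiCoeff Y u (del R v) w a c = -(c : ℂ) • jacobiCoeff Y u v w a (c - 1) := by
  have h1 : ∑ m ∈ Finset.range (a + 1),
      ((a.choose m : ℂ) * m) • Y (Y u v (m - 1)) w (a + c - m) =
      ∑ m ∈ Finset.range (a + 1),
        ((a.choose m : ℂ) * ((a : ℂ) - m)) • Y (Y u v m) w (a + c - m - 1) := by
    rw [Finset.sum_range_succ', Finset.sum_range_succ]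
    simp only [Nat.cast_zero, mul_zero, zero_smul, add_zero, sub_self, Nat.add_sub_cancel]
    refine Finset.sum_congr rfl fun m hm => ?_
    have hm' := (Finset.mem_range.1 hm).le
    have h := congrArg (Nat.cast : ℕ → ℂ) (Nat.choose_succ_right_eq a m)
    rw [show a + c - (m + 1) = a + c - m - 1 by omega]
    congr 1
    push_cast [hm'] at h ⊢
    exact h
  simp only [jacobiCoeff_eq, hT'.apply, map_add, map_smul, LinearMap.add_apply,
    LinearMap.smul_apply, Finsupp.add_apply, Finsupp.smul_apply, hT.apply, smul_add, smul_smul,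
    Finset.sum_add_distrib, h1, Finset.smul_sum]
  rw [← Finset.sum_add_distrib]
  refine Finset.sum_congr rfl fun m hm => ?_
  have hm' := Nat.lt_succ_iff.1 (Finset.mem_range.1 hm)
  rw [← add_smul]
  rcases c with _ | c
  · have : (a.choose m : ℂ) * -((a + 0 - m : ℕ) : ℂ) + (a.choose m : ℂ) * ((a : ℂ) - m) = 0 := by
      push_cast [hm', add_zero]
      ring
    rw [this]
    simp
  · rw [show a + (c + 1) - m - 1 = a + (c + 1 - 1) - m by omega]
    congr 1
    rw [Nat.cast_sub (by omega)]
    push_cast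
    ring

lemma jacobiCoeff_del_right (hT' : RightTranslation Y) (u v w : R) (a c : ℕ) :
    jacobiCoeff Y u v (del R w) a c = del R (jacobiCoeff Y u v w a c) +
      (a : ℂ) • jacobiCoeff Y u v w (a - 1) c + (c : ℂ) • jacobiCoeff Y u v w a (c - 1) := by
  simp only [jacobiCoeff_eq, hT'.apply, smul_add, Finset.sum_add_distrib, map_sum, map_smul,
    add_assoc, Finset.smul_sum, smul_smul]
  congr 1
  have h1 : ∑ m ∈ Finset.range (a - 1 + 1),
      ((a : ℂ) * ((a - 1).choose m : ℂ)) • Y (Y u v m) w (a - 1 + c - m) =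
      ∑ m ∈ Finset.range (a + 1),
        ((a.choose m : ℂ) * ((a : ℂ) - m)) • Y (Y u v m) w (a + c - m - 1) := by
    rcases a with _ | a
    · simp
    · rw [Finset.sum_range_succ _ (a + 1)]
      simp only [sub_self, mul_zero, zero_smul, add_zero, Nat.add_sub_cancel]
      refine Finset.sum_congr rfl fun m hm => ?_
      have hm' := (Finset.mem_range.1 hm).le
      have h := congrArg (Nat.cast : ℕ → ℂ) (Nat.choose_mul_succ_eq a m)
      rw [show a + 1 + c - m - 1 = a + c - m by omega]
      congr 1
      push_cast [hm'] at h ⊢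
      linear_combination h
  rw [h1, ← Finset.sum_add_distrib]
  refine Finset.sum_congr rfl fun m hm => ?_
  have hm' := Nat.lt_succ_iff.1 (Finset.mem_range.1 hm)
  have h2 : (c : ℂ) • (a.choose m : ℂ) • Y (Y u v m) w (a + (c - 1) - m) =
      (c : ℂ) • (a.choose m : ℂ) • Y (Y u v m) w (a + c - m - 1) := by
    rcases c with _ | c
    · simp
    · rw [show a + (c + 1) - m - 1 = a + (c + 1 - 1) - m by omega]
  rw [← smul_smul (c : ℂ), h2, smul_smul, ← add_smul]
  congr 1
  rw [Nat.cast_sub (by omega)]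
  push_cast
  ring

/-- The Jacobi identity for the triple `(u, v, w)`, with sign `ε`. -/
def JacobiAt (Y : R →ₗ[ℂ] R →ₗ[ℂ] Polar R) (ε : ℂ) (u v w : R) : Prop :=
  ∀ a c, Y u (Y v w c) a - ε • Y v (Y u w a) c = jacobiCoeff Y u v w a c

lemma JacobiAt.del_left {ε : ℂ} {u v w : R} (hT : Translation Y) (h : JacobiAt Y ε u v w) :
    JacobiAt Y ε (del R u) v w := by
  intro a c
  rw [jacobiCoeff_del_left hT, ← h, hT.apply, hT.apply, map_smul, Finsupp.smul_apply, smul_sub,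
    smul_comm ε]

lemma JacobiAt.del_middle {ε : ℂ} {u v w : R} (hT : Translation Y) (hT' : RightTranslation Y)
    (h : JacobiAt Y ε u v w) : JacobiAt Y ε u (del R v) w := by
  intro a c
  rw [jacobiCoeff_del_middle hT hT', ← h, hT.apply, hT.apply, map_smul, Finsupp.smul_apply,
    smul_sub, smul_comm ε]

lemma JacobiAt.del_right {ε : ℂ} {u v w : R} (hT' : RightTranslation Y)
    (h : JacobiAt Y ε u v w) : JacobiAt Y ε u v (del R w) := by
  intro a c
  rw [jacobiCoeff_del_right hT', ← h, ← h, ← h]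
  simp only [hT'.apply, map_add, map_sub, map_smul, Finsupp.add_apply, Finsupp.smul_apply,
    smul_add, smul_sub, smul_comm ε]
  abel

lemma jacobiCoeff_zero_left (v w : R) (a c : ℕ) : jacobiCoeff Y 0 v w a c = 0 := by
  simp [jacobiCoeff_eq]

lemma jacobiCoeff_add_left (u u' v w : R) (a c : ℕ) :
    jacobiCoeff Y (u + u') v w a c = jacobiCoeff Y u v w a c + jacobiCoeff Y u' v w a c := by
  simp [jacobiCoeff_eq, Finset.sum_add_distrib]

lemma jacobiCoeff_smul_left (t : ℂ) (u v w : R) (a c : ℕ) :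
    jacobiCoeff Y (t • u) v w a c = t • jacobiCoeff Y u v w a c := by
  simp [jacobiCoeff_eq, Finset.smul_sum, smul_comm t]

lemma jacobiCoeff_add_middle (u v v' w : R) (a c : ℕ) :
    jacobiCoeff Y u (v + v') w a c = jacobiCoeff Y u v w a c + jacobiCoeff Y u v' w a c := by
  simp [jacobiCoeff_eq, Finset.sum_add_distrib]

lemma jacobiCoeff_smul_middle (t : ℂ) (u v w : R) (a c : ℕ) :
    jacobiCoeff Y u (t • v) w a c = t • jacobiCoeff Y u v w a c := by
  simp [jacobiCoeff_eq, Finset.smul_sum, smul_comm t]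

lemma jacobiCoeff_add_right (u v w w' : R) (a c : ℕ) :
    jacobiCoeff Y u v (w + w') a c = jacobiCoeff Y u v w a c + jacobiCoeff Y u v w' a c := by
  simp [jacobiCoeff_eq, Finset.sum_add_distrib]

lemma jacobiCoeff_smul_right (t : ℂ) (u v w : R) (a c : ℕ) :
    jacobiCoeff Y u v (t • w) a c = t • jacobiCoeff Y u v w a c := by
  simp [jacobiCoeff_eq, Finset.smul_sum, smul_comm t]

end Sesquilinear

end FormalCalculus

/-! ### Extension from generators -/

section Generators

variable {ι : ZMod 2 → Type*} {R : Type*} [AddCommGroup R] [Module ℂ R] [Module ℂ[X] R]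
  [IsScalarTower ℂ ℂ[X] R] {V : Submodule ℂ R} (hV : IsBaseChange ℂ[X] V.subtype)
  (Y : V →ₗ[ℂ] V →ₗ[ℂ] Polar R)

include hV in
/-- Induction over a free `ℂ[∂]`-module in terms of its generators. -/
lemma generator_induction (b : Module.Basis (Idx ι) ℂ V) {p : R → Prop} (h0 : p 0)
    (hadd : ∀ x y, p x → p y → p (x + y)) (hsmul : ∀ (c : ℂ) x, p x → p (c • x))
    (hgen : ∀ k n, p ((del R ^ n) (b k))) (x : R) : p x := by
  have hx : x ∈ Submodule.span ℂ[X] (Set.range (hV.basis b)) := by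
    rw [Module.Basis.span_eq]; trivial
  obtain ⟨f, rfl⟩ := (Finsupp.mem_span_range_iff_exists_finsupp).1 hx
  refine Finset.sum_induction _ p hadd h0 fun k _ => ?_
  change p (f k • hV.basis b k)
  rw [IsBaseChange.basis_apply, Submodule.subtype_apply]
  induction f k using Polynomial.induction_on' with
  | add q q' hq hq' => rw [add_smul]; exact hadd _ _ hq hq'
  | monomial n c =>
    rw [← mul_one c, ← smul_eq_mul, ← Polynomial.smul_monomial,
      Polynomial.monomial_one_right_eq_X_pow, smul_assoc, ← del_pow_apply]
    exact hsmul _ _ (hgen k n)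

lemma extend_gen (u v : V) : extend hV Y u v = Y u v := by
  have h := extend_smul_left hV Y 1 u v
  simpa using h

lemma extend_del_pow_right (u : R) (v : V) (m : ℕ) :
    extend hV Y u ((del R ^ m) v) = ∑ ij ∈ Finset.HasAntidiagonal.antidiagonal m,
      m.choose ij.1 • (delCoeff R ^ ij.2) (extend hV Y (((-del R) ^ ij.1) u) v) := by
  rw [extend_pow_right, Finset.Nat.sum_antidiagonal_eq_sum_range_succ_mk]
  simp only [Nat.cast_smul_eq_nsmul]

variable (b : Module.Basis (Idx ι) ℂ V)

include b in
lemma extend_del_right (u v : R) :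
    extend hV Y u (del R v) = delCoeff R (extend hV Y u v) - extend hV Y (del R u) v := by
  induction v using generator_induction hV b with
  | h0 => simp
  | hadd x y hx hy => simp only [map_add, hx, hy]; abel
  | hsmul c x hx => simp only [map_smul, hx, smul_sub]
  | hgen k n =>
    rw [← Module.End.mul_apply, ← pow_succ', extend_del_pow_right,
      Finset.sum_antidiagonal_choose_succ_nsmul
        (fun i j => (delCoeff R ^ j) (extend hV Y (((-del R) ^ i) u) (b k))),
      extend_del_pow_right, extend_del_pow_right, map_sum, sub_eq_add_neg, ← Finset.sum_neg_distrib]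
    congr 1
    · refine Finset.sum_congr rfl fun ij _ => ?_
      rw [pow_succ', Module.End.mul_apply, map_nsmul]
    · refine Finset.sum_congr rfl fun ij hij => ?_
      rw [pow_succ, Module.End.mul_apply, LinearMap.neg_apply, map_neg, map_neg,
        LinearMap.neg_apply, map_neg, smul_neg,
        ← Nat.choose_symm_of_eq_add (Finset.HasAntidiagonal.mem_antidiagonal.1 hij).symm]

include b in
lemma extend_translation : Translation (extend hV Y) := by
  intro u v
  rw [← del_apply]
  induction v using generator_induction hV b with
  | h0 => simp
  | hadd x y hx hy => simp only [map_add, hx, hy]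
  | hsmul c x hx => simp only [map_smul, hx]
  | hgen k n =>
    induction n generalizing u with
    | zero =>
      induction u using generator_induction hV b with
      | h0 => simp
      | hadd x y hx hy => simp only [map_add, LinearMap.add_apply, hx, hy]
      | hsmul c x hx => simp only [map_smul, LinearMap.smul_apply, hx]
      | hgen j m =>
        rw [pow_zero, Module.End.one_apply, ← Module.End.mul_apply, ← pow_succ',
          del_pow_apply, del_pow_apply, extend_smul_left, extend_smul_left, pow_succ', map_mul,
          Polynomial.aeval_X, Module.End.mul_apply]
    | succ n ih =>
      rw [pow_succ', Module.End.mul_apply, extend_del_right hV Y b, extend_del_right hV Y b, ih,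
        ih, ih, map_sub, delCoeff_ddz]

include b in
lemma extend_rightTranslation : RightTranslation (extend hV Y) := by
  intro u v
  rw [extend_del_right hV Y b, del_apply, extend_translation hV Y b]

section Graded

variable {𝓡 : ZMod 2 → Submodule ℂ R} (h𝓡 : IsGradedModule 𝓡) (hb : ∀ k, (b k : R) ∈ 𝓡 k.1)

include h𝓡 in
lemma del_pow_mem {i : ZMod 2} {u : R} (hu : u ∈ 𝓡 i) (n : ℕ) : (del R ^ n) u ∈ 𝓡 i := by
  induction n with
  | zero => simpa
  | succ n ih => rw [pow_succ', Module.End.mul_apply]; exact h𝓡.partial_mem _ _ ih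

include hV h𝓡 hb in
/-- `Rᵢ` is spanned by the elements `∂ⁿς_k` with `k` of parity `i`. -/
lemma eq_span_generators (i : ZMod 2) :
    𝓡 i = Submodule.span ℂ {x | ∃ (k : Idx ι) (n : ℕ), k.1 = i ∧ x = (del R ^ n) (b k)} := by
  set Q : ZMod 2 → Submodule ℂ R := fun i =>
    Submodule.span ℂ {x | ∃ (k : Idx ι) (n : ℕ), k.1 = i ∧ x = (del R ^ n) (b k)} with hQ
  have hle : ∀ i, Q i ≤ 𝓡 i := by
    intro i
    refine Submodule.span_le.2 ?_
    rintro _ ⟨k, n, rfl, rfl⟩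
    exact del_pow_mem h𝓡 (hb k) n
  have hsum : ∀ x : R, ∃ y ∈ Q i, ∃ z ∈ Q (i + 1), x = y + z := by
    intro x
    induction x using generator_induction hV b with
    | h0 => exact ⟨0, zero_mem _, 0, zero_mem _, by simp⟩
    | hadd x x' hx hx' =>
      obtain ⟨y, hy, z, hz, rfl⟩ := hx
      obtain ⟨y', hy', z', hz', rfl⟩ := hx'
      exact ⟨y + y', add_mem hy hy', z + z', add_mem hz hz', by abel⟩
    | hsmul c x hx =>
      obtain ⟨y, hy, z, hz, rfl⟩ := hx
      exact ⟨c • y, Submodule.smul_mem _ _ hy, c • z, Submodule.smul_mem _ _ hz, smul_add _ _ _⟩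
    | hgen k n =>
      have h2 : ∀ i j : ZMod 2, j = i ∨ j = i + 1 := by decide
      rcases h2 i k.1 with h | h
      · exact ⟨_, Submodule.subset_span ⟨k, n, h, rfl⟩, 0, zero_mem _, by simp⟩
      · exact ⟨0, zero_mem _, _, Submodule.subset_span ⟨k, n, h, rfl⟩, by simp⟩
  refine le_antisymm (fun x hx => ?_) (hle i)
  obtain ⟨y, hy, z, hz, rfl⟩ := hsum x
  have hzi : z ∈ 𝓡 i := (Submodule.add_mem_iff_right _ (hle i hy)).1 hx
  have hne : i ≠ i + 1 := by simp
  have hdis := h𝓡.isInternal.submodule_iSupIndep.pairwiseDisjoint hne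
  rw [Submodule.disjoint_def.1 hdis z hzi (hle _ hz), add_zero]
  exact hy

include hV h𝓡 hb in
lemma homogeneous_induction {i : ZMod 2} {p : R → Prop} (h0 : p 0)
    (hadd : ∀ x y, p x → p y → p (x + y)) (hsmul : ∀ (c : ℂ) x, p x → p (c • x))
    (hgen : ∀ k : Idx ι, k.1 = i → p (b k)) (hdel : ∀ x, p x → p (del R x)) {x : R}
    (hx : x ∈ 𝓡 i) : p x := by
  rw [eq_span_generators hV b h𝓡 hb] at hx
  induction hx using Submodule.span_induction with
  | zero => exact h0
  | add x y _ _ hx hy => exact hadd x y hx hy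
  | smul c x _ hx => exact hsmul c x hx
  | mem x hx =>
    obtain ⟨k, n, hk, rfl⟩ := hx
    induction n with
    | zero => exact hgen k hk
    | succ n ih => rw [pow_succ', Module.End.mul_apply]; exact hdel _ ih

include h𝓡 hb in
lemma extend_isGradedMap
    (hY : ∀ (i j : ZMod 2) (u v : V), (u : R) ∈ 𝓡 i → (v : R) ∈ 𝓡 j → ∀ m, Y u v m ∈ 𝓡 (i + j)) :
    IsGradedMap 𝓡 (extend hV Y) := by
  intro i j u hu v hv
  refine homogeneous_induction hV b h𝓡 hb (p := fun u => ∀ m, extend hV Y u v m ∈ 𝓡 (i + j))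
    (by simp) (fun x y hx hy m => ?_) (fun c x hx m => ?_) (fun k hk => ?_) (fun x hx m => ?_) hu
  · simpa using add_mem (hx m) (hy m)
  · simpa using Submodule.smul_mem _ c (hx m)
  · refine homogeneous_induction hV b h𝓡 hb (p := fun v => ∀ m, extend hV Y (b k) v m ∈ 𝓡 (i + j))
      (by simp) (fun x y hx hy m => ?_) (fun c x hx m => ?_) (fun l hl m => ?_)
      (fun x hx m => ?_) hv
    · simpa using add_mem (hx m) (hy m)
    · simpa using Submodule.smul_mem _ c (hx m)
    · rw [extend_gen]
      exact hY i j _ _ (hk ▸ hb k) (hl ▸ hb l) m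
    · rw [(extend_rightTranslation hV Y b).apply]
      exact add_mem (h𝓡.partial_mem _ _ (hx m)) (Submodule.smul_mem _ _ (hx _))
  · rw [(extend_translation hV Y b).apply]
    exact Submodule.smul_mem _ _ (hx _)

include h𝓡 hb in
/-- Skew-symmetry on generators extends to `R`, by sesquilinearity. -/
lemma skewSymmetry_iff : SkewSymmetry 𝓡 (extend hV Y) ↔
    ∀ k l : Idx ι, Y (b k) (b l) = sgn k.1 l.1 • skewMap R (Y (b l) (b k)) := by
  constructor
  · intro h k l
    ext n
    have := h k.1 l.1 _ (hb k) _ (hb l) n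
    rwa [extend_gen, extend_gen, skewCoeff_eq] at this
  · intro h i j u hu v hv
    suffices hs : extend hV Y u v = sgn i j • skewMap R (extend hV Y v u) by
      intro l
      rw [hs, Finsupp.smul_apply, skewCoeff_eq]
    have hT := extend_translation hV Y b
    have hT' := extend_rightTranslation hV Y b
    refine homogeneous_induction hV b h𝓡 hb
      (p := fun u => extend hV Y u v = sgn i j • skewMap R (extend hV Y v u))
      (by simp) (fun x y hx hy => ?_) (fun c x hx => ?_) (fun k hk => ?_) (fun x hx => ?_) hu
    · simp only [map_add, LinearMap.add_apply, hx, hy, smul_add]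
    · simp only [map_smul, LinearMap.smul_apply, hx, smul_comm c]
    · refine homogeneous_induction hV b h𝓡 hb
        (p := fun v => extend hV Y (b k) v = sgn i j • skewMap R (extend hV Y v (b k)))
        (by simp) (fun x y hx hy => ?_) (fun c x hx => ?_) (fun l hl => ?_) (fun x hx => ?_) hv
      · simp only [map_add, LinearMap.add_apply, hx, hy, smul_add]
      · simp only [map_smul, LinearMap.smul_apply, hx, smul_comm c]
      · rw [extend_gen, extend_gen, h, hk, hl]
      · rw [hT', del_apply, hT, hx, skewMap_ddz, smul_sub, map_smul, map_smul]
    · rw [hT', del_apply, hT, hx, map_sub, skewMap_delCoeff, skewMap_ddz, map_smul, sub_sub_cancel]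

include h𝓡 hb in
/-- The Jacobi identity on generators extends to `R`, by sesquilinearity. -/
lemma jacobiIdentity_iff : JacobiIdentity 𝓡 (extend hV Y) ↔
    ∀ k l m : Idx ι, JacobiAt (extend hV Y) (sgn k.1 l.1) (b k) (b l) (b m) := by
  constructor
  · intro h k l m a c
    exact h k.1 l.1 _ (hb k) _ (hb l) _ a c
  · intro h i j u hu v hv w
    have hT := extend_translation hV Y b
    have hT' := extend_rightTranslation hV Y b
    change JacobiAt (extend hV Y) (sgn i j) u v w
    refine homogeneous_induction hV b h𝓡 hb
      (p := fun u => JacobiAt (extend hV Y) (sgn i j) u v w)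
      (fun a c => by simp [jacobiCoeff_zero_left]) (fun x y hx hy a c => ?_)
      (fun t x hx a c => ?_) (fun k hk => ?_) (fun x hx => hx.del_left hT) hu
    · rw [jacobiCoeff_add_left, ← hx, ← hy]
      simp only [map_add, LinearMap.add_apply, Finsupp.add_apply, smul_add]
      abel
    · rw [jacobiCoeff_smul_left, ← hx]
      simp only [map_smul, LinearMap.smul_apply, Finsupp.smul_apply, smul_sub, smul_comm t]
    refine homogeneous_induction hV b h𝓡 hb
      (p := fun v => JacobiAt (extend hV Y) (sgn i j) (b k) v w)
      (fun a c => by simp [jacobiCoeff_eq]) (fun x y hx hy a c => ?_)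
      (fun t x hx a c => ?_) (fun l hl => ?_) (fun x hx => hx.del_middle hT hT') hv
    · rw [jacobiCoeff_add_middle, ← hx, ← hy]
      simp only [map_add, LinearMap.add_apply, Finsupp.add_apply, smul_add]
      abel
    · rw [jacobiCoeff_smul_middle, ← hx]
      simp only [map_smul, LinearMap.smul_apply, Finsupp.smul_apply, smul_sub, smul_comm t]
    induction w using generator_induction hV b with
    | h0 => intro a c; simp [jacobiCoeff_eq]
    | hadd x y hx hy =>
      intro a c
      rw [jacobiCoeff_add_right, ← hx, ← hy]
      simp only [map_add, Finsupp.add_apply, smul_add]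
      abel
    | hsmul t x hx =>
      intro a c
      rw [jacobiCoeff_smul_right, ← hx]
      simp only [map_smul, Finsupp.smul_apply, smul_sub, smul_comm t]
    | hgen m n =>
      induction n with
      | zero =>
        have := h k l m
        rwa [hk, hl] at this
      | succ n ih => rw [pow_succ', Module.End.mul_apply]; exact ih.del_right hT'

end Graded

end Generators

/-! ### Evaluation of `R`-valued symbols in `𝒜` -/

section EvalOp

variable {ι : ZMod 2 → Type*} {M N : Type*} [AddCommGroup M] [Module ℂ M] [AddCommGroup N]
  [Module ℂ N]

/-- For a linear map `T : M → 𝒜` and `f ∈ 𝒜`, the linear map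
`∑ aₙ z^{-n-1} ↦ ∑ (1/n!) T(aₙ) (d/dx)^n(f)` on `M[z⁻¹]z⁻¹`. -/
def evalOp (T : M →ₗ[ℂ] SAlg ι) (f : SAlg ι) : Polar M →ₗ[ℂ] SAlg ι :=
  Finsupp.lsum ℂ fun n => (n.factorial : ℂ)⁻¹ • (LinearMap.mulRight ℂ ((ddx ι ^ n) f) ∘ₗ T)

lemma evalOp_single (T : M →ₗ[ℂ] SAlg ι) (f : SAlg ι) (n : ℕ) (a : M) :
    evalOp T f (Finsupp.single n a) = (n.factorial : ℂ)⁻¹ • (T a * (ddx ι ^ n) f) := by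
  simp [evalOp]

lemma evalOp_apply (T : M →ₗ[ℂ] SAlg ι) (f : SAlg ι) (F : Polar M) :
    evalOp T f F = F.sum fun n a => (n.factorial : ℂ)⁻¹ • (T a * (ddx ι ^ n) f) := rfl

lemma evalOp_mapRange (T : N →ₗ[ℂ] SAlg ι) (φ : M →ₗ[ℂ] N) (f : SAlg ι) (F : Polar M) :
    evalOp T f (Finsupp.mapRange.linearMap φ F) = evalOp (T ∘ₗ φ) f F := by
  induction F using Finsupp.induction_linear with
  | zero => simp
  | add F G hF hG => simp only [map_add, hF, hG]
  | single n a => simp [evalOp_single]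

lemma evalOp_ddz (T : M →ₗ[ℂ] SAlg ι) (f : SAlg ι) (F : Polar M) :
    evalOp T f (ddz M F) = evalOp T (-ddx ι f) F := by
  induction F using Finsupp.induction_linear with
  | zero => simp
  | add F G hF hG => simp only [map_add, hF, hG]
  | single n a =>
    have h : ddz M (Finsupp.single n a) = -((n : ℂ) + 1) • Finsupp.single (n + 1) a := by
      rw [ddz, Finsupp.lsum_single]
      rfl
    rw [h, map_smul, evalOp_single, evalOp_single, map_neg, mul_neg, pow_succ,
      Module.End.mul_apply, smul_smul, Nat.factorial_succ, smul_neg, ← neg_smul]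
    have h2 : ((n + 1 : ℕ) : ℂ) ≠ 0 := Nat.cast_ne_zero.2 n.succ_ne_zero
    congr 1
    rw [Nat.cast_mul]
    push_cast at h2 ⊢
    field_simp

/-- Right multiplication by fresh variables makes the coefficients of a symbol visible. -/
lemma evalOp_psi_eq_zero (T : M →ₗ[ℂ] SAlg ι) (k : Idx ι) (p : ℕ) (F : Polar M)
    (hF : ∀ i ∈ F.support, ∀ n, p ≤ n → partialDer (k, n) (T (F i)) = 0)
    (h : evalOp T (psi k p) F = 0) (i : ℕ) : T (F i) = 0 := by
  by_cases hi : i ∈ F.support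
  · rw [evalOp_apply, Finsupp.sum] at h
    have h1 := eq_zero_of_sum_mul_psi k p F.support
      (fun i => (i.factorial : ℂ)⁻¹ • T (F i))
      (fun i hi n hn => by rw [map_smul, hF i hi n hn, smul_zero])
      (by simpa only [ddx_pow_psi, smul_mul_assoc] using h) hi
    exact (smul_eq_zero.1 h1).resolve_left
      (inv_ne_zero (Nat.cast_ne_zero.2 i.factorial_ne_zero))
  · rw [Finsupp.notMem_support_iff.1 hi, map_zero]

/-- The exchange of the two variables in `M[z₁⁻¹, z₂⁻¹]z₁⁻¹z₂⁻¹`. -/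
def flipPolar (M : Type*) [AddCommGroup M] [Module ℂ M] :
    Polar (Polar M) →ₗ[ℂ] Polar (Polar M) :=
  Finsupp.lsum ℂ fun n => Finsupp.lsum ℂ fun m => Finsupp.lsingle m ∘ₗ Finsupp.lsingle n

lemma flipPolar_single (n m : ℕ) (a : M) :
    flipPolar M (Finsupp.single n (Finsupp.single m a)) =
      Finsupp.single m (Finsupp.single n a) := by
  simp only [flipPolar, Finsupp.lsum_single, LinearMap.comp_apply, Finsupp.lsingle_apply]

lemma polar_polar_induction {L : Type*} [AddCommGroup L] {p : Polar (Polar L) → Prop} (h0 : p 0)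
    (hadd : ∀ F G, p F → p G → p (F + G))
    (hsingle : ∀ n m a, p (Finsupp.single n (Finsupp.single m a))) (F : Polar (Polar L)) :
    p F := by
  induction F using Finsupp.induction_linear with
  | zero => exact h0
  | add F G hF hG => exact hadd F G hF hG
  | single n A =>
    induction A using Finsupp.induction_linear with
    | zero => simpa using h0
    | add A B hA hB => rw [Finsupp.single_add]; exact hadd _ _ hA hB
    | single m a => exact hsingle n m a

lemma flipPolar_apply (F : Polar (Polar M)) (n m : ℕ) : flipPolar M F n m = F m n := by
  induction F using polar_polar_induction with
  | h0 => simp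
  | hadd F G hF hG => simp only [map_add, Finsupp.add_apply, hF, hG]
  | hsingle i j a =>
    rw [flipPolar_single]
    by_cases h1 : i = m <;> by_cases h2 : j = n <;> simp [h1, h2]

lemma evalOp_evalOp_flip (T : M →ₗ[ℂ] SAlg ι) {i j : ZMod 2} {f g : SAlg ι} (hf : f ∈ homog ι i)
    (hg : g ∈ homog ι j) (F : Polar (Polar M)) :
    evalOp (evalOp T g) f F = sgn i j • evalOp (evalOp T f) g (flipPolar M F) := by
  induction F using polar_polar_induction with
  | h0 => simp
  | hadd F G hF hG => simp only [map_add, hF, hG, smul_add]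
  | hsingle n m a =>
    simp only [flipPolar_single, evalOp_single, smul_mul_assoc, mul_assoc]
    rw [homog_comm (ddx_pow_mem hg m) (ddx_pow_mem hf n), mul_smul_comm, sgn_comm j,
      smul_smul, smul_smul, smul_smul, smul_smul]
    congr 1
    ring

/-- The map `f(x) ↦ Res_x f(x) / ((z₁ - x)^{n+1} (z₂ - x))` on `M[x⁻¹]x⁻¹`: the
coefficient of `z₂^{-m-1} z₁^{-l-1}` of the image is `(l choose n) f₍ₘ₊ₗ₋ₙ₎` for `n ≤ l`. -/
def jacobiShift (M : Type*) [AddCommGroup M] [Module ℂ M] (n : ℕ) :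
    Polar M →ₗ[ℂ] Polar (Polar M) :=
  Finsupp.lsum ℂ fun p => ∑ ij ∈ Finset.HasAntidiagonal.antidiagonal p,
    ((n + ij.1).choose n : ℂ) • (Finsupp.lsingle ij.2 ∘ₗ Finsupp.lsingle (n + ij.1))

lemma jacobiShift_single (n p : ℕ) (a : M) :
    jacobiShift M n (Finsupp.single p a) = ∑ ij ∈ Finset.HasAntidiagonal.antidiagonal p,
      ((n + ij.1).choose n : ℂ) • Finsupp.single ij.2 (Finsupp.single (n + ij.1) a) := by
  simp only [jacobiShift, Finsupp.lsum_single, LinearMap.sum_apply, LinearMap.smul_apply,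
    LinearMap.comp_apply, Finsupp.lsingle_apply]

lemma jacobiShift_apply (n : ℕ) (F : Polar M) (m l : ℕ) :
    jacobiShift M n F m l =
      if n ≤ l then (l.choose (l - n) : ℂ) • F (m + (l - n)) else 0 := by
  induction F using Finsupp.induction_linear with
  | zero => simp
  | add F G hF hG =>
    simp only [map_add, Finsupp.add_apply, hF, hG]
    split_ifs <;> simp
  | single p a =>
    rw [jacobiShift_single, Finset.sum_apply', Finset.sum_apply']
    by_cases h : n ≤ l ∧ p = m + (l - n)
    · obtain ⟨hn, rfl⟩ := h
      rw [if_pos hn, Finset.sum_eq_single (l - n, m)]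
      · simp [Nat.add_sub_cancel' hn, Nat.choose_symm hn]
      · rintro ⟨i, j⟩ hij hne
        rw [Finset.HasAntidiagonal.mem_antidiagonal] at hij
        have : j ≠ m := by
          rintro rfl
          apply hne
          ext <;> simp at hij ⊢
          omega
        simp [Finsupp.single_eq_of_ne' this]
      · intro h'
        exact absurd (Finset.HasAntidiagonal.mem_antidiagonal.2 (add_comm _ _)) h'
    · have h2 : (if n ≤ l then (l.choose (l - n) : ℂ) • (Finsupp.single p a) (m + (l - n))
          else 0) = 0 := by
        split_ifs with hn
        · rw [Finsupp.single_eq_of_ne' (fun hp => h ⟨hn, hp⟩), smul_zero]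
        · rfl
      rw [h2]
      refine Finset.sum_eq_zero fun ij hij => ?_
      rw [Finset.HasAntidiagonal.mem_antidiagonal] at hij
      by_cases h1 : ij.2 = m
      · have h3 : n + ij.1 ≠ l := by
          intro h3
          exact h (by omega)
        simp [h1, Finsupp.single_eq_of_ne' h3]
      · simp [Finsupp.single_eq_of_ne' h1]

lemma evalOp_evalOp_jacobiShift (T : M →ₗ[ℂ] SAlg ι) (f g : SAlg ι) (n : ℕ) (F : Polar M) :
    evalOp (evalOp T f) g (jacobiShift M n F) =
      (n.factorial : ℂ)⁻¹ • evalOp T ((ddx ι ^ n) f * g) F := by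
  induction F using Finsupp.induction_linear with
  | zero => simp
  | add F G hF hG => simp only [map_add, hF, hG, smul_add]
  | single p a =>
    rw [jacobiShift_single, map_sum, evalOp_single, ddx_pow_mul, Finset.mul_sum, Finset.smul_sum,
      Finset.smul_sum]
    refine Finset.sum_congr rfl fun ij hij => ?_
    rw [Finset.HasAntidiagonal.mem_antidiagonal] at hij
    simp only [map_smul, evalOp_single, smul_mul_assoc, mul_assoc]
    rw [← Module.End.mul_apply, ← pow_add, ← Nat.cast_smul_eq_nsmul ℂ, mul_smul_comm, smul_smul,
      smul_smul, smul_smul, smul_smul, add_comm ij.1 n]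
    congr 1
    subst hij
    have h1 (k : ℕ) : (k.factorial : ℂ) ≠ 0 := Nat.cast_ne_zero.2 k.factorial_ne_zero
    rw [Nat.cast_add_choose, Nat.cast_add_choose]
    have := h1 n
    have := h1 ij.1
    have := h1 ij.2
    have := h1 (n + ij.1)
    have := h1 (ij.1 + ij.2)
    field_simp

end EvalOp

/-- The scalars embed into `𝒜`: they are separated by the augmentation `ψ ↦ 0`. -/
lemma algebraMap_injective (ι : ZMod 2 → Type*) : Function.Injective (algebraMap ℂ (SAlg ι)) := by
  let ε : SAlg ι →ₐ[ℂ] ℂ := SAlg.lift (FreeAlgebra.lift ℂ fun _ => 0) (by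
    rintro x y ⟨a, b⟩
    simp)
  intro c d h
  simpa using congrArg ε h

lemma mem_range_ddx_of_tilde {ι : ZMod 2 → Type*} {x : SAlg ι} (h : tilde x = 0) :
    x ∈ LinearMap.range (ddx ι) :=
  (Submodule.Quotient.mk_eq_zero _).1 h

/-! ### The operator attached to `Y` in terms of symbols -/

section Bridge

variable {ι : ZMod 2 → Type*} {R : Type*} [AddCommGroup R] [Module ℂ R] [Module ℂ[X] R]
  [IsScalarTower ℂ ℂ[X] R] {V : Submodule ℂ R} (hV : IsBaseChange ℂ[X] V.subtype)
  (b : Module.Basis (Idx ι) ℂ V)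

/-- The linear map on `R` with `∂ⁿς_k ↦ T k n`. -/
def liftGen {M : Type*} [AddCommGroup M] [Module ℂ M] (T : Idx ι → ℕ → M) : R →ₗ[ℂ] M :=
  (Finsupp.lsum ℂ fun k => Polynomial.lsum fun n => LinearMap.toSpanSingleton ℂ M (T k n)) ∘ₗ
    ((hV.basis b).repr.restrictScalars ℂ).toLinearMap

lemma repr_gen (k : Idx ι) (n : ℕ) :
    (hV.basis b).repr ((del R ^ n) (b k)) = Finsupp.single k (X ^ n) := by
  have h : (b k : R) = hV.basis b k := by rw [IsBaseChange.basis_apply, Submodule.subtype_apply]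
  rw [del_pow_apply, h, map_smul, Module.Basis.repr_self, Finsupp.smul_single, smul_eq_mul, mul_one]

lemma liftGen_gen {M : Type*} [AddCommGroup M] [Module ℂ M] (T : Idx ι → ℕ → M) (k : Idx ι)
    (n : ℕ) : liftGen hV b T ((del R ^ n) (b k)) = T k n := by
  have h : liftGen hV b T ((del R ^ n) (b k)) =
      (Finsupp.lsum ℂ fun k => Polynomial.lsum fun n => LinearMap.toSpanSingleton ℂ M (T k n))
        ((hV.basis b).repr ((del R ^ n) (b k))) := rfl
  rw [h, repr_gen, Finsupp.lsum_single, Polynomial.lsum_apply,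
    ← Polynomial.monomial_one_right_eq_X_pow, Polynomial.sum_monomial_index] <;> simp

/-- The embedding `R → 𝒜` with `∂ⁿς_k ↦ ψ_k^{(n)}`. -/
def symb : R →ₗ[ℂ] SAlg ι := liftGen hV b psi

lemma symb_gen (k : Idx ι) (n : ℕ) : symb hV b ((del R ^ n) (b k)) = psi k n :=
  liftGen_gen hV b psi k n

lemma symb_apply (a : R) : symb hV b a = ∑ k ∈ ((hV.basis b).repr a).support,
    ∑ n ∈ ((hV.basis b).repr a k).support, ((hV.basis b).repr a k).coeff n • psi k n := by
  change (Finsupp.lsum ℂ fun k => Polynomial.lsum fun n => LinearMap.toSpanSingleton ℂ _ (psi k n))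
        ((hV.basis b).repr a) = _
  rw [Finsupp.lsum_apply, Finsupp.sum]
  refine Finset.sum_congr rfl fun k _ => ?_
  rw [Polynomial.lsum_apply, Polynomial.sum]
  rfl

lemma symb_del (a : R) : symb hV b (del R a) = ddx ι (symb hV b a) := by
  induction a using generator_induction hV b with
  | h0 => simp
  | hadd x y hx hy => simp only [map_add, hx, hy]
  | hsmul c x hx => simp only [map_smul, hx]
  | hgen k n => rw [← Module.End.mul_apply, ← pow_succ', symb_gen, symb_gen, ddx_psi]

lemma partialDer_symb (k : Idx ι) (n : ℕ) (a : R) : partialDer (k, n) (symb hV b a) =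
    algebraMap ℂ _ (((hV.basis b).repr a k).coeff n) := by
  have hs (c : ℂ) (p : ℂ[X]) : (c • p).coeff n = c * p.coeff n := by simp
  have hr (c : ℂ) (x : R) : (hV.basis b).repr (c • x) = c • (hV.basis b).repr x :=
    ((hV.basis b).repr.restrictScalars ℂ).map_smul c x
  induction a using generator_induction hV b with
  | h0 => simp
  | hadd x y hx hy => simp only [map_add, hx, hy, Finsupp.add_apply, Polynomial.coeff_add]
  | hsmul c x hx =>
    rw [map_smul, map_smul, hx, hr, Finsupp.smul_apply, hs, map_mul, Algebra.smul_def]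
  | hgen j m =>
    rw [symb_gen, repr_gen]
    by_cases h : (j, m) = (k, n)
    · obtain ⟨rfl, rfl⟩ := Prod.mk.inj h
      simp [partialDer_psi_self]
    · rw [partialDer_psi_of_ne h]
      by_cases hj : j = k
      · subst hj
        have hm : n ≠ m := fun hm => h (by rw [hm])
        simp [Polynomial.coeff_X_pow, hm]
      · simp [Finsupp.single_eq_of_ne' hj]

lemma symb_injective {a : R} (h : symb hV b a = 0) : a = 0 := by
  rw [← (hV.basis b).repr.map_eq_zero_iff]
  ext k n
  have h1 := partialDer_symb hV b k n a
  rw [h, map_zero] at h1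
  simpa using algebraMap_injective ι (h1.symm.trans (map_zero _).symm)

variable (Y : V →ₗ[ℂ] V →ₗ[ℂ] Polar R) {𝓡 : ZMod 2 → Submodule ℂ R}

lemma evalOp_del {T : R →ₗ[ℂ] SAlg ι} (hT : ∀ a, T (del R a) = ddx ι (T a)) (f : SAlg ι)
    (F : Polar R) : evalOp T f (delCoeff R F - ddz R F) = ddx ι (evalOp T f F) := by
  rw [map_sub, evalOp_ddz]
  induction F using Finsupp.induction_linear with
  | zero => simp
  | add F G hF hG => simp only [map_add, ← hF, ← hG]; abel
  | single n a =>
    rw [delCoeff_single, evalOp_single, evalOp_single, evalOp_single, map_smul, ddx_mul, hT,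
      map_neg, mul_neg, smul_neg, sub_neg_eq_add, smul_add, ← Module.End.mul_apply,
      ← Module.End.mul_apply, (Commute.refl (ddx ι)).pow_left]

include hV in
/-- The parity condition in `opCoeff` is automatic for a graded `Y`. -/
lemma opCoeff_eq (h𝓡 : IsGradedModule 𝓡) (hb : ∀ k, (b k : R) ∈ 𝓡 k.1)
    (hY : ∀ (i j : ZMod 2) (u v : V), (u : R) ∈ 𝓡 i → (v : R) ∈ 𝓡 j → ∀ m, Y u v m ∈ 𝓡 (i + j))
    (r c : Idx ι) (n : ℕ) :
    opCoeff hV b Y r c n = (n.factorial : ℂ)⁻¹ • symb hV b (Y (b c) (b r) n) := by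
  have hsupp : ∀ {i : ZMod 2} {a : R}, a ∈ 𝓡 i → ∀ k : Idx ι, k.1 ≠ i →
      (hV.basis b).repr a k = 0 := by
    intro i a ha k hk
    refine homogeneous_induction hV b h𝓡 hb (p := fun a => (hV.basis b).repr a k = 0)
      (by simp) (fun x y hx hy => ?_) (fun c x hx => ?_) (fun j hj => ?_) (fun x hx => ?_) ha
    · rw [map_add, Finsupp.add_apply, hx, hy, add_zero]
    · rw [← one_smul ℂ[X] x, ← smul_assoc, map_smul, Finsupp.smul_apply, hx, smul_zero]
    · have h := repr_gen hV b j 0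
      rw [pow_zero, Module.End.one_apply] at h
      rw [h, Finsupp.single_eq_of_ne]
      rintro rfl
      exact hk hj
    · rw [del_apply, map_smul, Finsupp.smul_apply, hx, smul_zero]
  rw [opCoeff, symb_apply, Finset.smul_sum, Finset.sum_filter_of_ne]
  · refine Finset.sum_congr rfl fun k _ => ?_
    rw [Finset.smul_sum]
    refine Finset.sum_congr rfl fun m _ => ?_
    rw [smul_smul, structConst]
  · intro k hk hne
    by_contra hk'
    exact (Finsupp.mem_support_iff.1 hk) (hsupp (hY _ _ _ _ (hb c) (hb r) n) k hk')

section Graded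

variable (h𝓡 : IsGradedModule 𝓡) (hb : ∀ k, (b k : R) ∈ 𝓡 k.1)
  (hY : ∀ (i j : ZMod 2) (u v : V), (u : R) ∈ 𝓡 i → (v : R) ∈ 𝓡 j → ∀ m, Y u v m ∈ 𝓡 (i + j))

include h𝓡 hb hY in
lemma sum_hamOp_coeff (r c : Idx ι) {M : Type*} [AddCommMonoid M] (t : ℕ → SAlg ι → M)
    (ht : ∀ n, t n 0 = 0) : ((hamOp hV b Y).coeff r c).sum t =
      (Y (b c) (b r)).sum fun n a => t n ((n.factorial : ℂ)⁻¹ • symb hV b a) := by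
  have hc (n : ℕ) : (hamOp hV b Y).coeff r c n =
      (n.factorial : ℂ)⁻¹ • symb hV b (Y (b c) (b r) n) := opCoeff_eq hV b Y h𝓡 hb hY r c n
  refine (Finsupp.sum_of_support_subset ((hamOp hV b Y).coeff r c)
    (s := (Y (b c) (b r)).support) (fun n hn => ?_) t fun n _ => ht n).trans ?_
  · rw [Finsupp.mem_support_iff] at hn ⊢
    rintro h0
    rw [hc, h0, map_zero, smul_zero] at hn
    exact hn rfl
  · refine Finset.sum_congr rfl fun n _ => ?_
    rw [hc]

include h𝓡 hb hY in
lemma diffOp_hamOp (r c : Idx ι) (f : SAlg ι) : MatDiffOp.diffOp ((hamOp hV b Y).coeff r c) f =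
    evalOp (symb hV b) f (Y (b c) (b r)) := by
  rw [MatDiffOp.diffOp_apply, sum_hamOp_coeff hV b Y h𝓡 hb hY _ _ _ (by simp), evalOp_apply]
  simp only [smul_mul_assoc]

include h𝓡 hb hY in
lemma toLin_hamOp_single (c r : Idx ι) (f : SAlg ι) (hf : f ∈ homog ι c.1) :
    ((hamOp hV b Y).toLin (single c f hf)).1 r = evalOp (symb hV b) f (Y (b c) (b r)) := by
  rw [MatDiffOp.toLin_apply, ← diffOp_hamOp hV b Y h𝓡 hb hY]
  exact Finsupp.sum_single_index (map_zero _)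

include h𝓡 hb hY in
lemma derApply_hamOp_single (ξ : GBar ι) (c r : Idx ι) (f : SAlg ι) (hf : f ∈ homog ι c.1) :
    ((hamOp hV b Y).derApply ξ (single c f hf)).1 r =
      evalOp (der ξ ∘ₗ symb hV b) f (Y (b c) (b r)) := by
  rw [MatDiffOp.derApply_apply, evalOp_apply]
  refine (Finsupp.sum_single_index (by simp)).trans ?_
  rw [sum_hamOp_coeff hV b Y h𝓡 hb hY _ _ _ (by simp)]
  simp only [map_smul, smul_mul_assoc, LinearMap.comp_apply]

lemma pair_single (c : Idx ι) (f : SAlg ι) (hf : f ∈ homog ι c.1) (ξ : GBar ι) :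
    (pair (single c f hf) ξ).1 = tilde (ξ.1 c * f) := by
  rw [pair_val]
  congr 1
  exact Finsupp.sum_single_index (by simp)

/-! ### Skew-symmetry -/

lemma tilde_evalOp_skewMap (f g : SAlg ι) {i j : ZMod 2} (hf : f ∈ homog ι i)
    (hg : g ∈ homog ι j) (F : Polar R) :
    tilde (evalOp (symb hV b) f (skewMap R F) * g) =
      -(sgn i j • tilde (evalOp (symb hV b) g F * f)) := by
  induction F using Finsupp.induction_linear with
  | zero => simp
  | add F G hF hG => simp only [map_add, add_mul, hF, hG, smul_add, neg_add]
  | single m a =>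
    have hs (n : ℕ) : symb hV b ((del R ^ n) a) = (ddx ι ^ n) (symb hV b a) := by
      induction n with
      | zero => simp
      | succ n ih =>
        rw [pow_succ', Module.End.mul_apply, symb_del, ih, pow_succ', Module.End.mul_apply]
    -- The Leibniz rule: the sum over the coefficients of `e^{x∂}` is a single derivative.
    have h : evalOp (symb hV b) f (skewMap R (Finsupp.single m a)) =
        ((-1 : ℂ) ^ (m + 1) * (m.factorial : ℂ)⁻¹) • (ddx ι ^ m) (symb hV b a * f) := by
      rw [skewMap_single, map_sum, ddx_pow_mul, ← Finset.Nat.sum_antidiagonal_swap,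
        Finset.Nat.sum_antidiagonal_eq_sum_range_succ_mk, Finset.smul_sum]
      refine Finset.sum_congr rfl fun l hl => ?_
      have hl' := Nat.lt_succ_iff.1 (Finset.mem_range.1 hl)
      rw [evalOp_single, map_smul, hs, smul_mul_assoc, smul_smul, ← Nat.cast_smul_eq_nsmul ℂ,
        smul_smul]
      congr 1
      simp only [Prod.swap]
      rw [Nat.choose_symm hl', Nat.cast_choose ℂ hl']
      have h1 (k : ℕ) : (k.factorial : ℂ) ≠ 0 := Nat.cast_ne_zero.2 k.factorial_ne_zero
      have := h1 l
      have := h1 m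
      have := h1 (m - l)
      field_simp
    have hpow : ((-ddx ι) ^ m) g = (-1 : ℂ) ^ m • (ddx ι ^ m) g := by
      rw [← neg_one_smul ℂ (ddx ι), _root_.smul_pow]
      rfl
    rw [h, smul_mul_assoc, map_smul, tilde_ddx_pow_mul, hpow, mul_smul_comm, map_smul, mul_assoc,
      homog_comm hf (ddx_pow_mem hg m), evalOp_single, smul_mul_assoc, mul_smul_comm, map_smul,
      map_smul, mul_assoc, smul_smul, smul_smul, smul_smul, ← neg_smul]
    congr 1
    have : (-1 : ℂ) ^ m * (-1) ^ m = 1 := by rw [← mul_pow]; simp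
    rw [pow_succ]
    linear_combination (-(m.factorial : ℂ)⁻¹ * sgn i j) * this

include h𝓡 hb hY in
lemma pair_hamOp_single (c r : Idx ι) (f g : SAlg ι) (hf : f ∈ homog ι c.1)
    (hg : g ∈ homog ι r.1) :
    (pair (single r g hg) ((hamOp hV b Y).toLin (single c f hf)) +
      pair (single c f hf) ((hamOp hV b Y).toLin (single r g hg))).1 =
    tilde (evalOp (symb hV b) f
      (Y (b c) (b r) - sgn c.1 r.1 • skewMap R (Y (b r) (b c))) * g) := by
  rw [Submodule.coe_add, pair_single, pair_single, toLin_hamOp_single hV b Y h𝓡 hb hY,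
    toLin_hamOp_single hV b Y h𝓡 hb hY, map_sub, sub_mul, map_sub, map_smul, smul_mul_assoc,
    map_smul, tilde_evalOp_skewMap hV b f g hf hg, smul_neg, smul_smul, sgn_mul_self, one_smul,
    sub_neg_eq_add]

lemma symbol_eq_zero (c : Idx ι) (F : Polar R)
    (h : ∀ N, evalOp (symb hV b) (psi c N) F = 0) : F = 0 := by
  obtain ⟨p, hp⟩ := exists_order_finset F.support fun i => symb hV b (F i)
  ext i
  exact symb_injective hV b
    (evalOp_psi_eq_zero _ c p F (fun i hi n hn => hp i hi c n hn) (h p) i)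

include h𝓡 hb hY in
/-- `H` is skew-symmetric if and only if `Y` is so on the generators. -/
theorem isSkew_iff : IsSkew (hamOp hV b Y).toLin ↔
    ∀ k l : Idx ι, Y (b k) (b l) = sgn k.1 l.1 • skewMap R (Y (b l) (b k)) := by
  constructor
  · intro h c r
    rw [← sub_eq_zero]
    refine symbol_eq_zero hV b c _ fun N => ?_
    refine eq_zero_of_mul_mem_range_ddx r fun g hg => mem_range_ddx_of_tilde ?_
    rw [← pair_hamOp_single hV b Y h𝓡 hb hY c r _ g (psi_mem c N) hg, h, neg_add_cancel]
    rfl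
  · intro h u v
    rw [← add_eq_zero_iff_eq_neg]
    have z1 (ξ : GBar ι) : pair 0 ξ = 0 := LinearMap.congr_fun (map_zero (pairing ι)) ξ
    have z2 (u : Omega ι) : pair u 0 = 0 := map_zero (pairing ι u)
    induction u using omega_induction with
    | h0 => simp only [z1, map_zero, z2, add_zero]
    | hadd u u' hu hu' =>
      rw [map_add, pair_add_left, pair_add_right, add_add_add_comm, hu, hu', add_zero]
    | hsingle r g hg =>
      induction v using omega_induction with
      | h0 => simp only [z1, map_zero, z2, add_zero]
      | hadd v v' hv hv' =>
        rw [map_add, pair_add_left, pair_add_right, add_add_add_comm, hv, hv', add_zero]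
      | hsingle c f hf =>
        ext
        rw [pair_hamOp_single hV b Y h𝓡 hb hY, sub_eq_zero.2 (h c r)]
        simp

end Graded

end Bridge

/-! ### The Jacobi identity -/

section Jacobi

variable {ι : ZMod 2 → Type*} {R : Type*} [AddCommGroup R] [Module ℂ R] [Module ℂ[X] R]
  [IsScalarTower ℂ ℂ[X] R] {V : Submodule ℂ R} (hV : IsBaseChange ℂ[X] V.subtype)
  (b : Module.Basis (Idx ι) ℂ V) (Y : V →ₗ[ℂ] V →ₗ[ℂ] Polar R)

/-- The map `R ⊗ 𝒜 → Ω₀`, `∂ⁿς_k ⊗ F ↦ (-d/dx)ⁿ(F)` in the component `k`, for a fixed `F ∈ 𝒜`.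
It identifies `R ⊗ 𝒜` modulo the image of `∂ ⊗ 1 + 1 ⊗ d/dx` with `V ⊗ 𝒜`. -/
def toForm (F : SAlg ι) : R →ₗ[ℂ] (Idx ι →₀ SAlg ι) :=
  liftGen hV b fun k n => Finsupp.single k (((-ddx ι) ^ n) F)

lemma toForm_gen (F : SAlg ι) (k : Idx ι) (n : ℕ) :
    toForm hV b F ((del R ^ n) (b k)) = Finsupp.single k (((-ddx ι) ^ n) F) :=
  liftGen_gen hV b _ k n

lemma toForm_del (F : SAlg ι) (a : R) : toForm hV b F (del R a) = toForm hV b (-ddx ι F) a := by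
  induction a using generator_induction hV b with
  | h0 => simp
  | hadd x y hx hy => simp only [map_add, hx, hy]
  | hsmul c x hx => simp only [map_smul, hx]
  | hgen k n =>
    rw [← Module.End.mul_apply, ← pow_succ', toForm_gen, toForm_gen, pow_succ,
      Module.End.mul_apply, LinearMap.neg_apply]

lemma tilde_toForm (ξ : GBar ι) (F : SAlg ι) (a : R) :
    tilde (Finsupp.lsum ℂ (fun k => LinearMap.mulLeft ℂ (ξ.1 k)) (toForm hV b F a)) =
      tilde (der ξ (symb hV b a) * F) := by
  induction a using generator_induction hV b with
  | h0 => simp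
  | hadd x y hx hy => simp only [map_add, add_mul, hx, hy]
  | hsmul c x hx => simp only [map_smul, smul_mul_assoc, hx]
  | hgen k n =>
    rw [toForm_gen, symb_gen, Finsupp.lsum_single, LinearMap.mulLeft_apply, der_psi,
      tilde_ddx_pow_mul]

lemma evalOp_extend_gen (r k : Idx ι) (F : SAlg ι) (n : ℕ) :
    evalOp (symb hV b) F (extend hV Y ((del R ^ n) (b k)) (b r)) =
      evalOp (symb hV b) (((-ddx ι) ^ n) F) (Y (b k) (b r)) := by
  induction n generalizing F with
  | zero => rw [pow_zero, pow_zero, Module.End.one_apply, Module.End.one_apply, extend_gen]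
  | succ n ih =>
    rw [pow_succ', Module.End.mul_apply, del_apply, extend_translation hV Y b, evalOp_ddz, ih,
      pow_succ, Module.End.mul_apply, LinearMap.neg_apply]

/-- The defect of the Jacobi identity for the generators `ς_c`, `ς_s` and `ς_r`; the coefficient of
`z₂^{-m-1} z₁^{-n-1}` is the value at `(m, n)`. -/
def jacobiDefect (c s r : Idx ι) : Polar (Polar R) :=
  Finsupp.mapRange.linearMap (extend hV Y (b c)) (Y (b s) (b r)) -
    sgn c.1 s.1 • flipPolar R (Finsupp.mapRange.linearMap (extend hV Y (b s)) (Y (b c) (b r))) -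
    (Y (b c) (b s)).sum fun n a => jacobiShift R n (extend hV Y a (b r))

lemma jacobiDefect_apply (c s r : Idx ι) (m n : ℕ) : jacobiDefect hV b Y c s r m n =
    extend hV Y (b c) (extend hV Y (b s) (b r) m) n -
      sgn c.1 s.1 • extend hV Y (b s) (extend hV Y (b c) (b r) n) m -
      jacobiCoeff (extend hV Y) (b c) (b s) (b r) n m := by
  simp only [jacobiDefect, Finsupp.sub_apply, Finsupp.smul_apply, flipPolar_apply,
    Finsupp.mapRange.linearMap_apply, Finsupp.mapRange_apply, extend_gen]
  congr 1
  rw [jacobiCoeff, extend_gen, Finsupp.sum_apply, Finsupp.sum_apply]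
  simp only [jacobiShift_apply]

lemma jacobiDefect_eq_zero_iff (c s r : Idx ι) : jacobiDefect hV b Y c s r = 0 ↔
    JacobiAt (extend hV Y) (sgn c.1 s.1) (b c) (b s) (b r) := by
  constructor
  · intro h a m
    rw [← sub_eq_zero, ← jacobiDefect_apply, h]
    rfl
  · intro h
    ext m n
    rw [jacobiDefect_apply, sub_eq_zero.2 (h n m)]
    rfl

/-- An `R`-valued symbol in two variables vanishes if it gives the zero operator on `𝒜 × 𝒜`: it can
be read off from its values at `(ψ_c^{(N)}, ψ_s^{(M)})` for `M` much larger than `N`. -/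
lemma symbol_two_eq_zero (c s : Idx ι) (F : Polar (Polar R))
    (h : ∀ N M, evalOp (evalOp (symb hV b) (psi c N)) (psi s M) F = 0) : F = 0 := by
  obtain ⟨p, hp⟩ := exists_order_finset (F.support.biUnion fun m => (F m).support.image (m, ·))
    fun mn => symb hV b (F mn.1 mn.2)
  obtain ⟨q, hq⟩ := exists_order_finset F.support fun m => evalOp (symb hV b) (psi c p) (F m)
  ext m n
  have h1 := evalOp_psi_eq_zero _ s q F (fun m hm n hn => hq m hm s n hn) (h p q) m
  by_cases hm : m ∈ F.support
  · refine symb_injective hV b (evalOp_psi_eq_zero _ c p (F m) (fun i hi n hn => ?_) h1 n)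
    refine hp (m, i) ?_ c n hn
    exact Finset.mem_biUnion.2 ⟨m, hm, Finset.mem_image.2 ⟨i, hi, rfl⟩⟩
  · rw [Finsupp.notMem_support_iff.1 hm]
    rfl

variable {𝓡 : ZMod 2 → Submodule ℂ R} (h𝓡 : IsGradedModule 𝓡) (hb : ∀ k, (b k : R) ∈ 𝓡 k.1)
  (hY : ∀ (i j : ZMod 2) (u v : V), (u : R) ∈ 𝓡 i → (v : R) ∈ 𝓡 j → ∀ m, Y u v m ∈ 𝓡 (i + j))

include h𝓡 hb in
lemma toForm_mem {i : ZMod 2} {a : R} (ha : a ∈ 𝓡 i) {F : SAlg ι} (hF : F ∈ homog ι i) :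
    toForm hV b F a ∈ Omega ι := by
  refine homogeneous_induction hV b h𝓡 hb
    (p := fun a => ∀ F ∈ homog ι i, toForm hV b F a ∈ Omega ι)
    (fun F hF => by simp) (fun x y hx hy F hF => ?_) (fun c x hx F hF => ?_)
    (fun k hk F hF => ?_) (fun x hx F hF => ?_) ha F hF
  · rw [map_add]; exact add_mem (hx F hF) (hy F hF)
  · rw [map_smul]; exact Submodule.smul_mem _ _ (hx F hF)
  · have h := toForm_gen hV b F k 0
    rw [pow_zero, pow_zero, Module.End.one_apply, Module.End.one_apply] at h
    rw [h]
    exact (single k F (hk ▸ hF)).2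
  · rw [toForm_del]
    exact hx _ (neg_mem (ddx_pow_mem hF 1))

include h𝓡 hb hY in
/-- For `ξ = H(f ς_c)`, the derivation `∂_ξ` acts on `R ⊂ 𝒜` through the left multiplications by
`ς_c`. -/
lemma der_toLin_symb (c : Idx ι) (f : SAlg ι) (hf : f ∈ homog ι c.1) (a : R) :
    der ((hamOp hV b Y).toLin (single c f hf)) (symb hV b a) =
      evalOp (symb hV b) f (extend hV Y (b c) a) := by
  induction a using generator_induction hV b with
  | h0 => simp
  | hadd x y hx hy => simp only [map_add, hx, hy]
  | hsmul t x hx => simp only [map_smul, hx]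
  | hgen k n =>
    induction n with
    | zero =>
      rw [symb_gen, der_psi, pow_zero, pow_zero, Module.End.one_apply, Module.End.one_apply,
        toLin_hamOp_single hV b Y h𝓡 hb hY, extend_gen]
    | succ n ih =>
      rw [pow_succ', Module.End.mul_apply, symb_del, der_ddx, ih,
        extend_rightTranslation hV Y b, evalOp_del (symb_del hV b)]

include h𝓡 hb hY in
lemma derApply_toLin_single (c s r : Idx ι) (f g : SAlg ι) (hf : f ∈ homog ι c.1)
    (hg : g ∈ homog ι s.1) :
    ((hamOp hV b Y).derApply ((hamOp hV b Y).toLin (single c f hf)) (single s g hg)).1 r =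
      evalOp (evalOp (symb hV b) f) g
        (Finsupp.mapRange.linearMap (extend hV Y (b c)) (Y (b s) (b r))) := by
  rw [derApply_hamOp_single hV b Y h𝓡 hb hY, evalOp_mapRange]
  congr 2
  ext a
  exact der_toLin_symb hV b Y h𝓡 hb hY c f hf a

include h𝓡 hb hY in
/-- The 1-form `ζ : ξ ↦ u₂(∂_ξ(H)(u₁))` for `u₁ = f ς_c`, `u₂ = g ς_s` measures the failure of the
Jacobi identity through `∂_{Hu₁}(H)(u₂) - ∂_{Hu₂}(H)(u₁) - Hζ`. -/
lemma exists_form_single (c s : Idx ι) (f g : SAlg ι) (hf : f ∈ homog ι c.1)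
    (hg : g ∈ homog ι s.1) :
    ∃ ζ : Omega ι, (∀ ξ, pair ζ ξ = pair (single s g hg)
        ((hamOp hV b Y).derApply ξ (single c f hf))) ∧
      ∀ r, ((hamOp hV b Y).derApply ((hamOp hV b Y).toLin (single c f hf)) (single s g hg) -
        (hamOp hV b Y).derApply ((hamOp hV b Y).toLin (single s g hg)) (single c f hf) -
        (hamOp hV b Y).toLin ζ).1 r =
      evalOp (evalOp (symb hV b) f) g (jacobiDefect hV b Y c s r) := by
  -- `z` represents `∑ (1/n!) ς_c₍ₙ₎ς_s ⊗ f^{(n)} g`, the bracket of `ς_c ⊗ f` and `ς_s ⊗ g`.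
  let z : Idx ι →₀ SAlg ι := ∑ n ∈ (Y (b c) (b s)).support,
    (n.factorial : ℂ)⁻¹ • toForm hV b ((ddx ι ^ n) f * g) (Y (b c) (b s) n)
  have hz : z ∈ Omega ι := sum_mem fun n _ => Submodule.smul_mem _ _
    (toForm_mem hV b h𝓡 hb (hY _ _ _ _ (hb c) (hb s) n)
      (mul_mem_homog (ddx_pow_mem hf n) hg))
  refine ⟨⟨z, hz⟩, fun ξ => ?_, fun r => ?_⟩
  · ext
    rw [pair_single, derApply_hamOp_single hV b Y h𝓡 hb hY, pair_val]
    change tilde (Finsupp.lsum ℂ (fun k => LinearMap.mulLeft ℂ (ξ.1 k)) z) = _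
    rw [map_sum, map_sum, evalOp_apply, Finsupp.sum, Finset.sum_mul, map_sum]
    refine Finset.sum_congr rfl fun n _ => ?_
    rw [map_smul, map_smul, tilde_toForm, smul_mul_assoc, map_smul, mul_assoc]
    rfl
  · have h3 : ((hamOp hV b Y).toLin ⟨z, hz⟩).1 r = evalOp (evalOp (symb hV b) f) g
        ((Y (b c) (b s)).sum fun n a => jacobiShift R n (extend hV Y a (b r))) := by
      have hform (F : SAlg ι) (a : R) :
          Finsupp.lsum ℂ (fun k => MatDiffOp.diffOp ((hamOp hV b Y).coeff r k))
            (toForm hV b F a) = evalOp (symb hV b) F (extend hV Y a (b r)) := by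
        induction a using generator_induction hV b with
        | h0 => simp
        | hadd x y hx hy => simp only [map_add, LinearMap.add_apply, hx, hy]
        | hsmul t x hx => simp only [map_smul, LinearMap.smul_apply, hx]
        | hgen k n =>
          rw [toForm_gen, Finsupp.lsum_single, diffOp_hamOp hV b Y h𝓡 hb hY, evalOp_extend_gen]
      change Finsupp.lsum ℂ (fun k => MatDiffOp.diffOp ((hamOp hV b Y).coeff r k)) z = _
      rw [map_sum, Finsupp.sum, map_sum]
      refine Finset.sum_congr rfl fun n _ => ?_
      rw [map_smul, hform, evalOp_evalOp_jacobiShift]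
    have h2 := derApply_toLin_single hV b Y h𝓡 hb hY s c r g f hg hf
    rw [evalOp_evalOp_flip _ hf hg] at h2
    change ((hamOp hV b Y).derApply _ _).1 r - ((hamOp hV b Y).derApply _ _).1 r -
      ((hamOp hV b Y).toLin _).1 r = _
    rw [derApply_toLin_single hV b Y h𝓡 hb hY, h2, h3, jacobiDefect, map_sub, map_sub, map_smul]

include h𝓡 hb hY in
/-- The Jacobi identity says that the operators `∂_{Hu₁}(H)(u₂) - ∂_{Hu₂}(H)(u₁)` are of the
form `Hζ`, with `ζ` the 1-form `ξ ↦ u₂(∂_ξ(H)(u₁))`. -/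
lemma exists_form (hJ : ∀ c s r : Idx ι, JacobiAt (extend hV Y) (sgn c.1 s.1) (b c) (b s) (b r))
    (u₁ u₂ : Omega ι) :
    ∃ ζ : Omega ι, (∀ ξ, pair ζ ξ = pair u₂ ((hamOp hV b Y).derApply ξ u₁)) ∧
      (hamOp hV b Y).derApply ((hamOp hV b Y).toLin u₁) u₂ -
        (hamOp hV b Y).derApply ((hamOp hV b Y).toLin u₂) u₁ - (hamOp hV b Y).toLin ζ = 0 := by
  have z1 (ξ : GBar ι) : pair 0 ξ = 0 := LinearMap.congr_fun (map_zero (pairing ι)) ξ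
  have z2 (u : Omega ι) : pair u 0 = 0 := map_zero (pairing ι u)
  induction u₁ using omega_induction with
  | h0 =>
    refine ⟨0, fun ξ => ?_, ?_⟩
    · rw [z1, MatDiffOp.derApply_zero_right, z2]
    · rw [map_zero, MatDiffOp.derApply_zero_left, MatDiffOp.derApply_zero_right, sub_zero, sub_zero]
  | hadd u v hu hv =>
    obtain ⟨ζ, h1, h2⟩ := hu
    obtain ⟨η, h3, h4⟩ := hv
    refine ⟨ζ + η, fun ξ => ?_, ?_⟩
    · rw [pair_add_left, h1, h3, MatDiffOp.derApply_add_right, pair_add_right]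
    · rw [map_add, map_add, MatDiffOp.derApply_add_left, MatDiffOp.derApply_add_right]
      rw [← add_zero (0 : GBar ι)]
      nth_rewrite 1 [← h2]
      rw [← h4]
      abel
  | hsingle c f hf =>
    induction u₂ using omega_induction with
    | h0 =>
      refine ⟨0, fun ξ => ?_, ?_⟩
      · rw [z1, z1]
      · rw [map_zero, MatDiffOp.derApply_zero_left, MatDiffOp.derApply_zero_right, sub_zero,
          sub_zero]
    | hadd u v hu hv =>
      obtain ⟨ζ, h1, h2⟩ := hu
      obtain ⟨η, h3, h4⟩ := hv
      refine ⟨ζ + η, fun ξ => ?_, ?_⟩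
      · rw [pair_add_left, h1, h3, pair_add_left]
      · rw [map_add, map_add, MatDiffOp.derApply_add_left, MatDiffOp.derApply_add_right]
        rw [← add_zero (0 : GBar ι)]
        nth_rewrite 1 [← h2]
        rw [← h4]
        abel
    | hsingle s g hg =>
      obtain ⟨ζ, h1, h2⟩ := exists_form_single hV b Y h𝓡 hb hY c s f g hf hg
      refine ⟨ζ, h1, ?_⟩
      ext r
      rw [h2, (jacobiDefect_eq_zero_iff hV b Y c s r).2 (hJ c s r), map_zero]
      rfl

include h𝓡 hb hY in
/-- The closedness condition says that the family `∂_{Hu₁}(H)(u₂) - ∂_{Hu₂}(H)(u₁) - Hζ` pairs to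
zero with all 1-forms, so it vanishes by non-degeneracy, and with it the symbol `jacobiDefect`. -/
lemma jacobiAt_of_closedness (hH : IsSkew (hamOp hV b Y).toLin)
    (hcl : (hamOp hV b Y).Closedness) (c s r : Idx ι) :
    JacobiAt (extend hV Y) (sgn c.1 s.1) (b c) (b s) (b r) := by
  rw [← jacobiDefect_eq_zero_iff]
  refine symbol_two_eq_zero hV b c s _ fun N M => ?_
  obtain ⟨ζ, h1, h2⟩ := exists_form_single hV b Y h𝓡 hb hY c s (psi c N) (psi s M)
    (psi_mem c N) (psi_mem s M)
  refine eq_zero_of_mul_mem_range_ddx r fun h hh => mem_range_ddx_of_tilde ?_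
  rw [← h2, ← pair_single r h hh, MatDiffOp.pair_derApply_sub _ hH _ _ _ ζ h1, hcl, neg_zero]
  rfl

end Jacobi

end

end ConfHam

theorem theorem4p1 {R : Type*} [AddCommGroup R] [Module ℂ R] [Module ℂ[X] R]
    [IsScalarTower ℂ ℂ[X] R]
    -- `R` is a graded `ℂ[∂]`-module, free over the subspace `V`
    (𝓡 : ZMod 2 → Submodule ℂ R) (h𝓡 : ConfHam.IsGradedModule 𝓡)
    (V : Submodule ℂ R) (hV : IsBaseChange ℂ[X] V.subtype)
    -- `V` is a graded subspace, with a homogeneous basis `ς = b`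
    {ι : ZMod 2 → Type*} (b : Module.Basis (ConfHam.Idx ι) ℂ V)
    (hb : ∀ k, (b k : R) ∈ 𝓡 k.1)
    (Y : V →ₗ[ℂ] V →ₗ[ℂ] ConfHam.Polar R)
    (hY : ∀ (i j : ZMod 2) (u v : V), (u : R) ∈ 𝓡 i → (v : R) ∈ 𝓡 j →
      ∀ m, Y u v m ∈ 𝓡 (i + j)) :
    (ConfHam.IsConformalSuperalgebra 𝓡 (ConfHam.extend hV Y) ↔
      ConfHam.IsHamiltonian (ConfHam.hamOp hV b Y).toLin) ∧
    (ConfHam.SkewSymmetry 𝓡 (ConfHam.extend hV Y) ↔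
      ConfHam.IsSkew (ConfHam.hamOp hV b Y).toLin) ∧
    (ConfHam.IsSkew (ConfHam.hamOp hV b Y).toLin →
      (ConfHam.JacobiIdentity 𝓡 (ConfHam.extend hV Y) ↔
        (ConfHam.hamOp hV b Y).Closedness)) := by
  have hskew : ConfHam.SkewSymmetry 𝓡 (ConfHam.extend hV Y) ↔
      ConfHam.IsSkew (ConfHam.hamOp hV b Y).toLin :=
    (ConfHam.skewSymmetry_iff hV Y b h𝓡 hb).trans (ConfHam.isSkew_iff hV b Y h𝓡 hb hY).symm
  have hjac := ConfHam.jacobiIdentity_iff hV Y b h𝓡 hb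
  have hham (hs : ConfHam.IsSkew (ConfHam.hamOp hV b Y).toLin)
      (hJ : ConfHam.JacobiIdentity 𝓡 (ConfHam.extend hV Y)) :=
    (ConfHam.hamOp hV b Y).isHamiltonian_of_skew hs
      (ConfHam.exists_form hV b Y h𝓡 hb hY (hjac.1 hJ))
  have hcl (hs : ConfHam.IsSkew (ConfHam.hamOp hV b Y).toLin)
      (hc : (ConfHam.hamOp hV b Y).Closedness) :
      ConfHam.JacobiIdentity 𝓡 (ConfHam.extend hV Y) :=
    hjac.2 (ConfHam.jacobiAt_of_closedness hV b Y h𝓡 hb hY hs hc)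
  refine ⟨⟨fun h => (hham (hskew.1 h.skew) h.jacobi).2, fun h => ?_⟩, hskew,
    fun hs => ⟨fun hJ => (hham hs hJ).1, hcl hs⟩⟩
  exact ⟨h𝓡, ConfHam.extend_isGradedMap hV Y b h𝓡 hb hY, ConfHam.extend_translation hV Y b,
    hskew.2 h.skew, hcl h.skew ((ConfHam.hamOp hV b Y).closedness_of_isHamiltonian h)⟩
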